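/- Let $J,R,Q\in\mathbb{R}^{n\times n}$ and $B\in\mathbb{R}^{n\times m}$ with $J^{\mathsf T}=-J$, $R=R^{\mathsf T}\succeq 0$ and $Q=Q^{\mathsf T}\succ 0$; put $A:=(J-R)Q$ and $C:=B^{\mathsf T}Q$, and call $(J,R,Q,B)$ a port-Hamiltonian system. A linear system $(A',B',C')$ is called port-Hamiltonian with Hamiltonian $X$ if it arises in this way from some port-Hamiltonian system $(J',R',X,B')$, i.e. $A'=(J'-R')X$ and $C'=B'^{\mathsf T}X$. Suppose that $(A,B,C)$ is minimal, i.e. $(A,B)$ is controllable and $(A,C)$ is observable, and let $\gamma>1$. A real square matrix is called asymptotically stable if all its complex eigenvalues have negative real part. Consider the modified $\mathcal H_\infty$ filter equation $$A\hat Y+\hat YA^{\mathsf T}-(1-\gamma^{-2})\hat YC^{\mathsf T}C\hat Y+(1-\gamma^{-2})BB^{\mathsf T}+2R=0 \qquad (1)$$ and the modified $\mathcal H_\infty$ control equation $$(A+\gamma^{-2}\hat YC^{\mathsf T}C)^{\mathsf T}\hat X+\hat X(A+\gamma^{-2}\hat YC^{\mathsf T}C)-(1-\gamma^{-2})\hat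 XBB^{\mathsf T}\hat X+C^{\mathsf T}C=0. \qquad (2)$$ A real symmetric solution $\hat Y$ of (1) is stabilizing if $A-(1-\gamma^{-2})\hat YC^{\mathsf T}C$ is asymptotically stable; a real symmetric solution $\hat X$ of (2) is stabilizing if $A+\gamma^{-2}\hat YC^{\mathsf T}C-(1-\gamma^{-2})BB^{\mathsf T}\hat X$ is asymptotically stable. Then: 1. Equation (1) has exactly one stabilizing solution, namely $\hat Y=Q^{-1}$. 2. Equation (2) with this $\hat Y$ has exactly one stabilizing solution $\hat X$, and $\hat X\succ 0$. 3. The controller $(\hat A,\hat B,\hat C)$ given by $$\hat A:=A-(1-\gamma^{-2})\hat YC^{\mathsf T}C-BB^{\mathsf T}\hat X,\qquad \hat B:=\hat YC^{\mathsf T},\qquad \hat C:=B^{\mathsf T}\hat X$$ is port-Hamiltonian with Hamiltonian $\hat X$. 4. Suppose in addition that $(\hat A,\hat B,\hat C)$ satisfies the strong Lur'e equations: $\hat A$ is asymptotically stable, $\hat B$ has full column rank, and there are real symmetric positive definite matrices $P,S\in\mathbb{R}^{n\times n}$ and real matrices $L\in\mathbb{R}^{n\times m}$, $W\in\mathbb{R}^{m\times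 m}$ with $\hat A^{\mathsf T}P+P\hat A=-LL^{\mathsf T}-S$, $\hat C^{\mathsf T}-P\hat B=LW$ and $W^{\mathsf T}W=0$. Let $\ell$ be a non-negative integer and let $D_1\in\mathbb{R}^{n\times\ell}$, $D_2\in\mathbb{R}^{m\times\ell}$, $E_1\in\mathbb{R}^{\ell\times n}$, $E_2\in\mathbb{R}^{\ell\times m}$ be any matrices with $D_1D_1^{\mathsf T}=2R+(1-\gamma^{-2})BB^{\mathsf T}$, $D_2D_2^{\mathsf T}=I$, $D_1D_2^{\mathsf T}=0$, $E_1^{\mathsf T}E_1=C^{\mathsf T}C$, $E_2^{\mathsf T}E_2=I$, $E_1^{\mathsf T}E_2=0$, and let $$\mathbf A:=\begin{bmatrix}A&-B\hat C\\ \hat BC&\hat A\end{bmatrix},\qquad \mathbf D:=\begin{bmatrix}D_1\\ \hat BD_2\end{bmatrix},\qquad \mathbf E:=\begin{bmatrix}E_1&-E_2\hat C\end{bmatrix}.$$ Then $\mathbf A$ is asymptotically stable, and the closed-loop transfer function $T_{zw}(s)=\mathbf E(sI-\mathbf A)^{-1}\mathbf D$ satisfies $$\|T_{zw}\|_{\mathcal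 H_\infty}=\sup_{\omega\in\mathbb R}\|T_{zw}(i\omega)\|_2<\gamma,$$ where $\|\cdot\|_2$ is the spectral norm. -/

import Mathlib

open Matrix
open scoped ENNReal

/-- A real square matrix is asymptotically stable if all its complex eigenvalues
lie in the open left half-plane. -/
def AsymptoticallyStable {ι : Type*} [Fintype ι] [DecidableEq ι] (A : Matrix ι ι ℝ) : Prop :=
  ∀ z ∈ spectrum ℂ (A.map Complex.ofReal), z.re < 0

/-- The Kalman controllability matrix `[B, AB, …, A^(n-1) B]`. -/
def controllabilityMatrix {n m : ℕ} (A : Matrix (Fin n) (Fin n) ℝ) (B : Matrix (Fin n) (Fin m) ℝ) :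
    Matrix (Fin n) (Fin n × Fin m) ℝ :=
  Matrix.of fun i q => (A ^ (q.1 : ℕ) * B) i q.2

/-- The Kalman observability matrix, with block rows `C, CA, …, C A^(n-1)`. -/
def observabilityMatrix {n p : ℕ} (A : Matrix (Fin n) (Fin n) ℝ) (C : Matrix (Fin p) (Fin n) ℝ) :
    Matrix (Fin n × Fin p) (Fin n) ℝ :=
  Matrix.of fun q j => (C * A ^ (q.1 : ℕ)) q.2 j

/-- The system `(A, B, C)` is minimal: `(A, B)` is controllable and `(A, C)` is observable. -/
def IsMinimalSystem {n m p : ℕ} (A : Matrix (Fin n) (Fin n) ℝ) (B : Matrix (Fin n) (Fin m) ℝ)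
    (C : Matrix (Fin p) (Fin n) ℝ) : Prop :=
  (controllabilityMatrix A B).rank = n ∧ (observabilityMatrix A C).rank = n

/-- A port-Hamiltonian system `(J, R, Q, B)` without feedthrough, with `n` states and `m` inputs.
Over `ℝ`, `PosSemidef` and `PosDef` include symmetry. -/
structure PHSystem (n m : ℕ) where
  J : Matrix (Fin n) (Fin n) ℝ
  R : Matrix (Fin n) (Fin n) ℝ
  Q : Matrix (Fin n) (Fin n) ℝ
  B : Matrix (Fin n) (Fin m) ℝ
  J_skew : Jᵀ = -J
  R_posSemidef : R.PosSemidef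
  Q_posDef : Q.PosDef

/-- The system matrix `A = (J - R) Q`. -/
def PHSystem.A {n m : ℕ} (S : PHSystem n m) : Matrix (Fin n) (Fin n) ℝ := (S.J - S.R) * S.Q

/-- The output matrix `C = Bᵀ Q`. -/
def PHSystem.C {n m : ℕ} (S : PHSystem n m) : Matrix (Fin m) (Fin n) ℝ := S.Bᵀ * S.Q

/-- The linear system `(A, B, C)` is port-Hamiltonian with Hamiltonian `X`, i.e. it is given by
some port-Hamiltonian system `(J, R, X, B)`. -/
def IsPortHamiltonianWith {n m : ℕ} (A : Matrix (Fin n) (Fin n) ℝ) (B : Matrix (Fin n) (Fin m) ℝ)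
    (C : Matrix (Fin m) (Fin n) ℝ) (X : Matrix (Fin n) (Fin n) ℝ) : Prop :=
  ∃ S : PHSystem n m, S.Q = X ∧ S.A = A ∧ S.B = B ∧ S.C = C

/-- The square system `(A, B, C, D)` satisfies the strong Lur'e equations. -/
def SatisfiesStrongLure {n m : ℕ} (A : Matrix (Fin n) (Fin n) ℝ) (B : Matrix (Fin n) (Fin m) ℝ)
    (C : Matrix (Fin m) (Fin n) ℝ) (D : Matrix (Fin m) (Fin m) ℝ) : Prop :=
  AsymptoticallyStable A ∧ B.rank = m ∧
    ∃ (P S : Matrix (Fin n) (Fin n) ℝ) (L : Matrix (Fin n) (Fin m) ℝ)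
      (W : Matrix (Fin m) (Fin m) ℝ),
      P.PosDef ∧ S.PosDef ∧
      Aᵀ * P + P * A = -(L * Lᵀ) - S ∧
      Cᵀ - P * B = L * W ∧
      Wᵀ * W = D + Dᵀ

/-- `Y` is a (symmetric) stabilizing solution of the modified `H∞` filter equation
`A Y + Y Aᵀ - (1 - γ⁻²) Y Cᵀ C Y + (1 - γ⁻²) B Bᵀ + 2 R = 0`. -/
def IsStabilizingFilterSolution {n m : ℕ} (γ : ℝ) (A R : Matrix (Fin n) (Fin n) ℝ)
    (B : Matrix (Fin n) (Fin m) ℝ) (C : Matrix (Fin m) (Fin n) ℝ)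
    (Y : Matrix (Fin n) (Fin n) ℝ) : Prop :=
  Y.IsSymm ∧
    A * Y + Y * Aᵀ - (1 - (γ ^ 2)⁻¹) • (Y * Cᵀ * C * Y) + (1 - (γ ^ 2)⁻¹) • (B * Bᵀ)
      + (2 : ℝ) • R = 0 ∧
    AsymptoticallyStable (A - (1 - (γ ^ 2)⁻¹) • (Y * Cᵀ * C))

/-- `X` is a (symmetric) stabilizing solution of the modified `H∞` control equation
`(A + γ⁻² Y Cᵀ C)ᵀ X + X (A + γ⁻² Y Cᵀ C) - (1 - γ⁻²) X B Bᵀ X + Cᵀ C = 0`. -/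
def IsStabilizingControlSolution {n m : ℕ} (γ : ℝ) (A : Matrix (Fin n) (Fin n) ℝ)
    (B : Matrix (Fin n) (Fin m) ℝ) (C : Matrix (Fin m) (Fin n) ℝ)
    (Y X : Matrix (Fin n) (Fin n) ℝ) : Prop :=
  X.IsSymm ∧
    (A + (γ ^ 2)⁻¹ • (Y * Cᵀ * C))ᵀ * X + X * (A + (γ ^ 2)⁻¹ • (Y * Cᵀ * C))
      - (1 - (γ ^ 2)⁻¹) • (X * B * Bᵀ * X) + Cᵀ * C = 0 ∧
    AsymptoticallyStable (A + (γ ^ 2)⁻¹ • (Y * Cᵀ * C) - (1 - (γ ^ 2)⁻¹) • (B * Bᵀ * X))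

/-- The controller matrix `Â = A - (1 - γ⁻²) Y Cᵀ C - B Bᵀ X`. -/
noncomputable def controllerA {n m : ℕ} (γ : ℝ) (A : Matrix (Fin n) (Fin n) ℝ)
    (B : Matrix (Fin n) (Fin m) ℝ) (C : Matrix (Fin m) (Fin n) ℝ)
    (Y X : Matrix (Fin n) (Fin n) ℝ) : Matrix (Fin n) (Fin n) ℝ :=
  A - (1 - (γ ^ 2)⁻¹) • (Y * Cᵀ * C) - B * Bᵀ * X

/-- The controller matrix `B̂ = Y Cᵀ`. -/
def controllerB {n m : ℕ} (C : Matrix (Fin m) (Fin n) ℝ) (Y : Matrix (Fin n) (Fin n) ℝ) :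
    Matrix (Fin n) (Fin m) ℝ :=
  Y * Cᵀ

/-- The controller matrix `Ĉ = Bᵀ X`. -/
def controllerC {n m : ℕ} (B : Matrix (Fin n) (Fin m) ℝ) (X : Matrix (Fin n) (Fin n) ℝ) :
    Matrix (Fin m) (Fin n) ℝ :=
  Bᵀ * X

/-- System matrix of the closed loop of `(A, B, C)` and `(A', B', C')` under the power-conserving
interconnection `u' = y`, `u = -y'`. -/
def closedLoopA {n m : ℕ} (A : Matrix (Fin n) (Fin n) ℝ) (B : Matrix (Fin n) (Fin m) ℝ)
    (C : Matrix (Fin m) (Fin n) ℝ) (A' : Matrix (Fin n) (Fin n) ℝ) (B' : Matrix (Fin n) (Fin m) ℝ)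
    (C' : Matrix (Fin m) (Fin n) ℝ) : Matrix (Fin n ⊕ Fin n) (Fin n ⊕ Fin n) ℝ :=
  Matrix.fromBlocks A (-(B * C')) (B' * C) A'

/-- Closed-loop input matrix for the disturbance `w`: block rows `D₁` and `B' D₂`. -/
def closedLoopD {n m l : ℕ} (B' : Matrix (Fin n) (Fin m) ℝ) (D₁ : Matrix (Fin n) (Fin l) ℝ)
    (D₂ : Matrix (Fin m) (Fin l) ℝ) : Matrix (Fin n ⊕ Fin n) (Fin l) ℝ :=
  Matrix.fromRows D₁ (B' * D₂)

/-- Closed-loop output matrix for the observed variable `z`: block columns `E₁` and `-E₂ C'`. -/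
def closedLoopE {n m l : ℕ} (C' : Matrix (Fin m) (Fin n) ℝ) (E₁ : Matrix (Fin l) (Fin n) ℝ)
    (E₂ : Matrix (Fin l) (Fin m) ℝ) : Matrix (Fin l) (Fin n ⊕ Fin n) ℝ :=
  Matrix.fromCols E₁ (-(E₂ * C'))

/-- The transfer function `s ↦ E (s I - A)⁻¹ D`, for complex `s`. -/
noncomputable def transferFunction {ι κ κ' : Type*} [Fintype ι] [DecidableEq ι]
    (A : Matrix ι ι ℝ) (D : Matrix ι κ ℝ) (E : Matrix κ' ι ℝ) (s : ℂ) : Matrix κ' κ ℂ :=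
  E.map Complex.ofReal * (s • (1 : Matrix ι ι ℂ) - A.map Complex.ofReal)⁻¹ * D.map Complex.ofReal

open scoped Matrix.Norms.L2Operator in
/-- The `H∞` norm `sup_ω ‖T(iω)‖₂`, with the spectral norm (largest singular value) of matrices.
The supremum is taken in `[0, ∞]`. -/
noncomputable def hInfNorm {κ κ' : Type*} [Fintype κ] [Fintype κ'] [DecidableEq κ]
    (T : ℂ → Matrix κ' κ ℂ) : ℝ≥0∞ :=
  ⨆ ω : ℝ, ENNReal.ofReal ‖T ((ω : ℂ) * Complex.I)‖

open Filter Topology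

/-! ### Stability, the Cayley transform, and Lyapunov and Sylvester equations -/

section LinearAlgebra

variable {ι κ : Type*} [Fintype ι]

/-! The argument runs on energy balances. For `Y = Q⁻¹` the products `Y Cᵀ` and `A Y` collapse to
`B` and `J - R`, so the filter equation becomes an identity and its closed-loop matrix is `A - (1 -
γ⁻²) B C`: output damping, stable by LaSalle and observability
(`asymptoticallyStable_output_damping`). In both equations, the difference of two stabilizing
solutions solves a homogeneous Sylvester equation with stable coefficients, hence vanishes
(`riccati_stabilizing_unique`).

The control equation is solved variationally. Positive semidefinite supersolutions of bounded trace
form a compact set, and a large multiple of `Q` is a supersolution. At a trace minimizer the Newton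
correction must vanish, and with it the Riccati residual (`exists_riccati_solution`). Observability
makes the solution stabilizing and definite. Completing a square in the equation shows that the
controller dissipates the energy `X`, which is the port-Hamiltonian property.

The strong Lur'e equations without feedthrough give `Ĉ = B̂ᵀ P`, so `xᵀ Q x + yᵀ P y` decays along
the closed loop, `x` and `y` being the plant and controller states. For the norm bound put `e = x -
y`: the storage `γ² eᵀ Q e + yᵀ X y` has derivative `γ² |w|² - |z|² - γ² |w - w*|²`
(`dissipation_equality`). At frequency `iω` the derivative averages out, so `|z|² ≤ γ² |w|²` with
equality only for `w = w*`, and then everything is zero (`worstDisturbance_phasor_eq_zero`).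
Strictness survives the supremum because the transfer function is continuous on the imaginary axis
and vanishes at infinity. -/

lemma re_map_ofReal_mulVec (M : Matrix κ ι ℝ) (v : ι → ℂ) (i : κ) :
    ((M.map Complex.ofReal *ᵥ v) i).re = (M *ᵥ fun j => (v j).re) i := by
  simp [mulVec, dotProduct]

lemma im_map_ofReal_mulVec (M : Matrix κ ι ℝ) (v : ι → ℂ) (i : κ) :
    ((M.map Complex.ofReal *ᵥ v) i).im = (M *ᵥ fun j => (v j).im) i := by
  simp [mulVec, dotProduct]

lemma isClosed_posSemidef : IsClosed {X : Matrix ι ι ℝ | X.PosSemidef} := by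
  simp only [posSemidef_iff_dotProduct_mulVec, Set.ofPred_and, Set.ofPred_forall]
  refine IsClosed.inter ?_ (isClosed_iInter fun x => ?_)
  · exact isClosed_eq (continuous_id.matrix_conjTranspose) continuous_id
  · exact isClosed_le continuous_const
      (continuous_const.dotProduct (continuous_id.matrix_mulVec continuous_const))

lemma Matrix.PosSemidef.transpose_mul_mul {X : Matrix ι ι ℝ} (hX : X.PosSemidef) {κ : Type*}
    [Fintype κ] (N : Matrix ι κ ℝ) : (Nᵀ * X * N).PosSemidef := by
  simpa using hX.conjTranspose_mul_mul_same N

variable [DecidableEq ι]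

lemma mem_spectrum_iff_exists_mulVec {N : Matrix ι ι ℂ} {z : ℂ} :
    z ∈ spectrum ℂ N ↔ ∃ v ≠ 0, N *ᵥ v = z • v := by
  rw [spectrum.mem_iff, Matrix.isUnit_iff_isUnit_det, isUnit_iff_ne_zero, not_not,
    ← Matrix.exists_mulVec_eq_zero_iff]
  refine exists_congr fun v => and_congr_right fun _ => ?_
  rw [sub_mulVec, sub_eq_zero, Algebra.algebraMap_eq_smul_one, smul_mulVec, one_mulVec, eq_comm]

/-- Asymptotic stability in terms of the real and imaginary parts of eigenvectors. -/
lemma asymptoticallyStable_iff {M : Matrix ι ι ℝ} :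
    AsymptoticallyStable M ↔ ∀ (σ ω : ℝ) (a b : ι → ℝ), M *ᵥ a = σ • a - ω • b →
      M *ᵥ b = ω • a + σ • b → 0 ≤ σ → a = 0 ∧ b = 0 := by
  constructor
  · intro h σ ω a b ha hb hσ
    by_contra hne
    have hv : (fun i => (a i + b i * Complex.I : ℂ)) ≠ 0 := by
      intro h0
      apply hne
      constructor <;> funext i
      · simpa using congrArg Complex.re (congrFun h0 i)
      · simpa using congrArg Complex.im (congrFun h0 i)
    have := h ⟨σ, ω⟩ (mem_spectrum_iff_exists_mulVec.2 ⟨_, hv, ?_⟩)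
    · simp at this; linarith
    · funext i
      apply Complex.ext
      · rw [re_map_ofReal_mulVec]
        simpa using congrFun ha i
      · rw [im_map_ofReal_mulVec]
        have := congrFun hb i
        simp at this ⊢
        linarith
  · intro h z hz
    obtain ⟨v, hv, hvz⟩ := mem_spectrum_iff_exists_mulVec.1 hz
    by_contra hσ
    have := h z.re z.im (fun i => (v i).re) (fun i => (v i).im) ?_ ?_ (not_lt.1 hσ)
    · apply hv
      funext i
      exact Complex.ext (congrFun this.1 i) (congrFun this.2 i)
    · funext i
      rw [← re_map_ofReal_mulVec, hvz]; simp
    · funext i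
      rw [← im_map_ofReal_mulVec, hvz]; simp; ring

section
attribute [local instance] Matrix.linftyOpNormedRing Matrix.linftyOpNormedAlgebra

/-- Gelfand's formula: for `r` strictly between the spectral radius and `1`, eventually `‖N ^ k‖ < r
^ k`. -/
lemma tendsto_pow_zero_of_spectrum_norm_lt_one {N : Matrix ι ι ℂ}
    (h : ∀ z ∈ spectrum ℂ N, ‖z‖ < 1) : Tendsto (fun k : ℕ => N ^ k) atTop (𝓝 0) := by
  rcases subsingleton_or_nontrivial (Matrix ι ι ℂ) with hs | hs
  · exact tendsto_const_nhds.congr fun k => Subsingleton.elim _ _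
  have hr : spectralRadius ℂ N < (1 : NNReal) :=
    spectrum.spectralRadius_lt_of_forall_lt N fun z hz => by exact_mod_cast h z hz
  obtain ⟨r, hr0, hr1⟩ := ENNReal.lt_iff_exists_nnreal_btwn.1 hr
  have hr1' : r < 1 := by exact_mod_cast hr1
  have hev := (spectrum.pow_nnnorm_pow_one_div_tendsto_nhds_spectralRadius N).eventually
    (gt_mem_nhds hr0)
  refine tendsto_zero_iff_norm_tendsto_zero.2 ?_
  refine squeeze_zero' (Eventually.of_forall fun k => norm_nonneg _) ?_
    (tendsto_pow_atTop_nhds_zero_of_lt_one r.2 (by exact_mod_cast hr1') :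
      Tendsto (fun k : ℕ => (r : ℝ) ^ k) atTop (𝓝 0))
  filter_upwards [hev, eventually_gt_atTop 0] with k hk hk0
  have hk' : (‖N ^ k‖₊ : ℝ≥0∞) < (r : ℝ≥0∞) ^ (k : ℝ) := by
    have := ENNReal.rpow_lt_rpow hk (z := (k : ℝ)) (by positivity)
    rwa [← ENNReal.rpow_mul, one_div_mul_cancel (by positivity), ENNReal.rpow_one] at this
  rw [ENNReal.rpow_natCast] at hk'
  exact_mod_cast hk'.le
end

/-- The Cayley transform of a matrix. -/
noncomputable def cayley (M : Matrix ι ι ℝ) : Matrix ι ι ℝ := (1 + M) * (1 - M)⁻¹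

lemma AsymptoticallyStable.isUnit_one_sub {M : Matrix ι ι ℝ} (hM : AsymptoticallyStable M) :
    IsUnit (1 - M).det := by
  rw [isUnit_iff_ne_zero]
  intro h
  obtain ⟨v, hv, h0⟩ := Matrix.exists_mulVec_eq_zero_iff.2 h
  rw [sub_mulVec, one_mulVec, sub_eq_zero] at h0
  exact hv (asymptoticallyStable_iff.1 hM 1 0 v 0 (by simp [← h0]) (by simp) zero_le_one).1

/-- The Cayley transform carries the open left half-plane into the open unit disc. Decay of powers
then replaces the matrix exponential in the Lyapunov arguments below. -/
lemma AsymptoticallyStable.tendsto_cayley_pow {M : Matrix ι ι ℝ} (hM : AsymptoticallyStable M) :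
    Tendsto (fun k : ℕ => cayley M ^ k) atTop (𝓝 0) := by
  have hu := hM.isUnit_one_sub
  have key : Tendsto (fun k : ℕ => (cayley M).map Complex.ofReal ^ k) atTop (𝓝 0) := by
    apply tendsto_pow_zero_of_spectrum_norm_lt_one
    intro z hz
    obtain ⟨w, hw, hwz⟩ := mem_spectrum_iff_exists_mulVec.1 hz
    have hmap : ∀ X Y : Matrix ι ι ℝ, (X * Y).map Complex.ofReal =
        X.map Complex.ofReal * Y.map Complex.ofReal := fun X Y =>
      Matrix.map_mul (f := Complex.ofRealHom)
    set v := ((1 - M)⁻¹).map Complex.ofReal *ᵥ w with hv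
    have hone : (1 : Matrix ι ι ℝ).map Complex.ofReal = 1 :=
      Matrix.map_one _ Complex.ofReal_zero Complex.ofReal_one
    have hsub : (1 - M).map Complex.ofReal = 1 - M.map Complex.ofReal := by
      rw [← hone]; ext i j; exact Complex.ofReal_sub _ _
    have hadd : (1 + M).map Complex.ofReal = 1 + M.map Complex.ofReal := by
      rw [← hone]; ext i j; exact Complex.ofReal_add _ _
    have hwv : w = v - M.map Complex.ofReal *ᵥ v := by
      have : (1 - M.map Complex.ofReal) *ᵥ v = w := by
        rw [hv, mulVec_mulVec, ← hsub, ← hmap, mul_nonsing_inv _ hu, hone, one_mulVec]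
      rw [← this, sub_mulVec, one_mulVec]
    have hv0 : v ≠ 0 := by
      rintro h0
      rw [h0] at hwv
      simp [hw] at hwv
    have hz2 : v + M.map Complex.ofReal *ᵥ v = z • (v - M.map Complex.ofReal *ᵥ v) := by
      rw [← hwv, ← hwz, cayley, hmap, ← mulVec_mulVec, ← hv, hadd, add_mulVec, one_mulVec]
    have hz3 : (z + 1) • M.map Complex.ofReal *ᵥ v = (z - 1) • v := by
      have := hz2
      rw [smul_sub] at this
      rw [add_smul, sub_smul, one_smul, one_smul]
      linear_combination (exp := 1) this
    have hz1 : z + 1 ≠ 0 := by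
      intro h0
      rw [h0, zero_smul] at hz3
      rcases smul_eq_zero.1 hz3.symm with h1 | h1
      · have : (2 : ℂ) = 0 := by linear_combination h0 - h1
        norm_num at this
      · exact hv0 h1
    have := hM ((z - 1) / (z + 1)) (mem_spectrum_iff_exists_mulVec.2 ⟨v, hv0, by
      rw [div_eq_inv_mul, mul_smul, ← hz3, smul_smul, inv_mul_cancel₀ hz1, one_smul]⟩)
    -- The numerator of `Re ((z - 1) / (z + 1))` is `|z|² - 1`.
    rw [Complex.div_re, ← add_div] at this
    have hpos := Complex.normSq_pos.2 hz1
    rw [div_lt_iff₀ hpos, zero_mul] at this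
    simp at this
    rw [Complex.norm_def, Real.sqrt_lt' one_pos, Complex.normSq_apply]
    linarith
  refine tendsto_pi_nhds.2 fun i => tendsto_pi_nhds.2 fun j => ?_
  have := (Complex.continuous_re.tendsto _).comp
    (tendsto_pi_nhds.1 (tendsto_pi_nhds.1 key i) j)
  refine this.congr fun k => ?_
  have : (cayley M).map Complex.ofReal ^ k = (cayley M ^ k).map Complex.ofReal :=
    (map_pow (Complex.ofRealHom.mapMatrix) (cayley M) k).symm
  simp [this]

lemma tendsto_transpose_pow_mul_mul_pow {M N : Matrix ι ι ℝ} (hM : AsymptoticallyStable M)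
    (hN : AsymptoticallyStable N) (X : Matrix ι ι ℝ) :
    Tendsto (fun k : ℕ => (cayley M ^ k)ᵀ * X * cayley N ^ k) atTop (𝓝 0) := by
  have h1 : Tendsto (fun k : ℕ => (cayley M ^ k)ᵀ) atTop (𝓝 0) := by
    have := ((continuous_id.matrix_transpose).tendsto (0 : Matrix ι ι ℝ)).comp
      hM.tendsto_cayley_pow
    rwa [id, transpose_zero] at this
  simpa using (h1.mul_const X).mul hN.tendsto_cayley_pow

/-- Turns a continuous-time Sylvester operator into a discrete-time one, which can be iterated. -/
lemma transpose_mul_add_mul_eq_cayley {M N : Matrix ι ι ℝ} (hM : AsymptoticallyStable M)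
    (hN : AsymptoticallyStable N) (X : Matrix ι ι ℝ) :
    (cayley M)ᵀ * X * cayley N - X =
      (2 : ℝ) • (((1 - M)⁻¹)ᵀ * (Mᵀ * X + X * N) * (1 - N)⁻¹) := by
  have h1 : ((1 - M)⁻¹)ᵀ * (1 - M)ᵀ = 1 := by
    rw [← transpose_mul, mul_nonsing_inv _ hM.isUnit_one_sub, transpose_one]
  have h2 : (1 - N) * (1 - N)⁻¹ = 1 := mul_nonsing_inv _ hN.isUnit_one_sub
  have h3 : X = ((1 - M)⁻¹)ᵀ * ((1 - M)ᵀ * X * (1 - N)) * (1 - N)⁻¹ := by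
    calc X = (((1 - M)⁻¹)ᵀ * (1 - M)ᵀ) * X * ((1 - N) * (1 - N)⁻¹) := by rw [h1, h2]; simp
      _ = _ := by noncomm_ring
  have h4 : (cayley M)ᵀ * X * cayley N =
      ((1 - M)⁻¹)ᵀ * ((1 + M)ᵀ * X * (1 + N)) * (1 - N)⁻¹ := by
    rw [cayley, cayley, transpose_mul]; simp only [Matrix.mul_assoc]
  have h5 : (1 + M)ᵀ * X * (1 + N) = (1 - M)ᵀ * X * (1 - N) + (2 : ℝ) • (Mᵀ * X + X * N) := by
    simp only [transpose_add, transpose_sub, transpose_one, two_smul]; noncomm_ring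
  rw [h4, h5, mul_add, add_mul, ← h3, add_sub_cancel_left, Matrix.mul_smul, Matrix.smul_mul]

/-- Uniqueness for the Sylvester equation with asymptotically stable coefficients. -/
lemma eq_zero_of_sylvester {M N X : Matrix ι ι ℝ} (hM : AsymptoticallyStable M)
    (hN : AsymptoticallyStable N) (h : Mᵀ * X + X * N = 0) : X = 0 := by
  have h1 := transpose_mul_add_mul_eq_cayley hM hN X
  rw [h, mul_zero, zero_mul, smul_zero, sub_eq_zero] at h1
  have h2 : ∀ k : ℕ, (cayley M ^ k)ᵀ * X * cayley N ^ k = X := by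
    intro k
    induction k with
    | zero => simp
    | succ k ih =>
      rw [pow_succ, pow_succ', transpose_mul]
      calc _ = (cayley M)ᵀ * ((cayley M ^ k)ᵀ * X * cayley N ^ k) * cayley N := by
            rw [← pow_succ', pow_succ]; simp only [Matrix.mul_assoc]
        _ = X := by rw [ih, h1]
  exact tendsto_nhds_unique (tendsto_const_nhds.congr fun k => (h2 k).symm)
    (tendsto_transpose_pow_mul_mul_pow hM hN X)

/-- Solutions of a Lyapunov equation with stable coefficient are positive semidefinite. -/
lemma posSemidef_of_lyapunov {M X : Matrix ι ι ℝ} (hM : AsymptoticallyStable M)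
    (h : (-(Mᵀ * X + X * M)).PosSemidef) : X.PosSemidef := by
  have h1 : (X - (cayley M)ᵀ * X * cayley M).PosSemidef := by
    rw [← neg_sub, transpose_mul_add_mul_eq_cayley hM hM, ← smul_neg, ← Matrix.neg_mul,
      ← Matrix.mul_neg]
    exact (h.transpose_mul_mul _).smul zero_le_two
  -- Telescoping: each step adds a congruence of the preceding difference to the first one.
  have h2 : ∀ k : ℕ, (X - (cayley M ^ k)ᵀ * X * cayley M ^ k).PosSemidef := by
    intro k
    induction k with
    | zero => simpa using PosSemidef.zero
    | succ k ih =>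
      have := h1.add (ih.transpose_mul_mul (cayley M))
      convert this using 1
      rw [pow_succ, transpose_mul]
      noncomm_ring
  have h3 : Tendsto (fun k : ℕ => X - (cayley M ^ k)ᵀ * X * cayley M ^ k) atTop (𝓝 X) := by
    simpa using tendsto_const_nhds.sub (tendsto_transpose_pow_mul_mul_pow hM hM X)
  exact isClosed_posSemidef.mem_of_tendsto h3 (Eventually.of_forall h2)

/-- Solvability of the Lyapunov equation. -/
lemma exists_lyapunov {M : Matrix ι ι ℝ} (hM : AsymptoticallyStable M) (G : Matrix ι ι ℝ) :
    ∃ X, Mᵀ * X + X * M = G := by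
  let f : Matrix ι ι ℝ →ₗ[ℝ] Matrix ι ι ℝ :=
    LinearMap.mulLeft ℝ Mᵀ + LinearMap.mulRight ℝ M
  have hf : Function.Injective f := by
    rw [← LinearMap.ker_eq_bot, LinearMap.ker_eq_bot']
    exact fun X hX => eq_zero_of_sylvester hM hM hX
  exact LinearMap.injective_iff_surjective.1 hf G

/-- Positive semidefinite matrices of bounded trace form a compact set. -/
lemma isCompact_posSemidef_trace_le (t : ℝ) :
    IsCompact {X : Matrix ι ι ℝ | X.PosSemidef ∧ X.trace ≤ t} := by
  have hK : IsCompact (Set.univ.pi fun _ : ι => Set.univ.pi fun _ : ι => Set.Icc (-t) t) :=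
    isCompact_univ_pi fun _ => isCompact_univ_pi fun _ => isCompact_Icc
  refine hK.of_isClosed_subset (isClosed_posSemidef.inter
    (isClosed_le (continuous_id.matrix_trace) continuous_const)) ?_
  rintro (X : Matrix ι ι ℝ) ⟨hX, ht⟩ i - j -
  have hdiag : ∀ k, X k k ≤ t := fun k =>
    (Finset.single_le_sum (f := fun k => X k k) (fun k _ => hX.diag_nonneg)
      (Finset.mem_univ k)).trans ht
  have hsymm : X j i = X i j := hX.1.apply i j
  -- Testing on `eᵢ ± eⱼ` gives `|X i j| ≤ (X i i + X j j) / 2`.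
  have hq : ∀ s : ℝ, 0 ≤ X i i + s * X j i + s * (X i j + s * X j j) := fun s => by
    have := hX.dotProduct_mulVec_nonneg (Pi.single i 1 + s • Pi.single j 1)
    rw [mulVec_add, mulVec_smul, mulVec_single_one, mulVec_single_one] at this
    simpa [add_dotProduct, col_apply] using this
  have h1 := hq 1
  have h2 := hq (-1)
  have := hdiag i
  have := hdiag j
  constructor <;> linarith

end LinearAlgebra

/-! ### Algebraic Riccati equations -/

section Riccati

variable {ι κ : Type*} [Fintype ι] [Fintype κ]

lemma posSemidef_mul_transpose (B : Matrix ι κ ℝ) : (B * Bᵀ).PosSemidef := by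
  simpa using posSemidef_self_mul_conjTranspose B

lemma posSemidef_transpose_mul (C : Matrix κ ι ℝ) : (Cᵀ * C).PosSemidef := by
  simpa using posSemidef_conjTranspose_mul_self C

omit [Fintype ι] in
lemma Matrix.PosSemidef.transpose_eq {X : Matrix ι ι ℝ} (hX : X.PosSemidef) : Xᵀ = X := by
  simpa using hX.isHermitian.eq

lemma Matrix.PosSemidef.quad_nonneg {X : Matrix ι ι ℝ} (hX : X.PosSemidef) (v : ι → ℝ) :
    0 ≤ v ⬝ᵥ X *ᵥ v := by
  simpa using hX.dotProduct_mulVec_nonneg v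

lemma Matrix.PosSemidef.mulVec_eq_zero {X : Matrix ι ι ℝ} (hX : X.PosSemidef) {v : ι → ℝ}
    (h : v ⬝ᵥ X *ᵥ v = 0) : X *ᵥ v = 0 :=
  (hX.dotProduct_mulVec_zero_iff v).1 (by simpa using h)

lemma Matrix.PosSemidef.mulVec_eq_zero_of_add {X Y : Matrix ι ι ℝ} (hX : X.PosSemidef)
    (hY : Y.PosSemidef) {v : ι → ℝ} (h : (X + Y) *ᵥ v = 0) : X *ᵥ v = 0 ∧ Y *ᵥ v = 0 := by
  have h1 : v ⬝ᵥ X *ᵥ v + v ⬝ᵥ Y *ᵥ v = 0 := by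
    rw [← dotProduct_add, ← add_mulVec, h, dotProduct_zero]
  have h2 := hX.quad_nonneg v
  have h3 := hY.quad_nonneg v
  exact ⟨hX.mulVec_eq_zero (by linarith), hY.mulVec_eq_zero (by linarith)⟩

lemma transpose_mul_mulVec_eq_zero {C : Matrix κ ι ℝ} {v : ι → ℝ} (h : (Cᵀ * C) *ᵥ v = 0) :
    C *ᵥ v = 0 := by
  rw [← dotProduct_self_eq_zero, dotProduct_mulVec, vecMul_mulVec, ← dotProduct_mulVec, h,
    dotProduct_zero]

lemma dotProduct_mulVec_transpose (M : Matrix κ ι ℝ) (u : ι → ℝ) (v : κ → ℝ) :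
    u ⬝ᵥ Mᵀ *ᵥ v = (M *ᵥ u) ⬝ᵥ v := by
  rw [mulVec_transpose, dotProduct_comm u, ← dotProduct_mulVec, dotProduct_comm]

lemma quad_lyapunov {M P : Matrix ι ι ℝ} (hP : Pᵀ = P) (v : ι → ℝ) :
    v ⬝ᵥ (Mᵀ * P + P * M) *ᵥ v = 2 * (v ⬝ᵥ P *ᵥ (M *ᵥ v)) := by
  have h : v ⬝ᵥ P *ᵥ (M *ᵥ v) = (P *ᵥ v) ⬝ᵥ (M *ᵥ v) := by
    conv_lhs => rw [← hP]
    exact dotProduct_mulVec_transpose _ _ _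
  rw [add_mulVec, dotProduct_add, ← mulVec_mulVec, ← mulVec_mulVec, dotProduct_mulVec_transpose,
    h, dotProduct_comm (M *ᵥ v), two_mul]

/-- The energy balance along an eigenvector with real part `a` and imaginary part `b`. -/
lemma energy_balance {P : Matrix ι ι ℝ} (hP : Pᵀ = P) {σ ω : ℝ} {a b u v : ι → ℝ}
    (hu : u = σ • a - ω • b) (hv : v = ω • a + σ • b) :
    a ⬝ᵥ P *ᵥ u + b ⬝ᵥ P *ᵥ v = σ * (a ⬝ᵥ P *ᵥ a + b ⬝ᵥ P *ᵥ b) := by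
  have h : a ⬝ᵥ P *ᵥ b = b ⬝ᵥ P *ᵥ a := by
    conv_lhs => rw [← hP]
    rw [dotProduct_mulVec_transpose, dotProduct_comm]
  rw [hu, hv]
  simp only [mulVec_sub, mulVec_add, mulVec_smul, dotProduct_sub, dotProduct_add, dotProduct_smul,
    smul_eq_mul, h]
  ring

variable [DecidableEq ι]

/-- A Lyapunov criterion for asymptotic stability in the style of LaSalle. -/
lemma asymptoticallyStable_of_lyapunov {M P G : Matrix ι ι ℝ} (hP : P.PosSemidef)
    (hG : G.PosSemidef) (h : Mᵀ * P + P * M = -G)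
    (hker : ∀ (σ ω : ℝ) (a b : ι → ℝ), M *ᵥ a = σ • a - ω • b →
      M *ᵥ b = ω • a + σ • b → G *ᵥ a = 0 → G *ᵥ b = 0 → a = 0 ∧ b = 0) :
    AsymptoticallyStable M := by
  refine asymptoticallyStable_iff.2 fun σ ω a b ha hb hσ => ?_
  -- For `0 ≤ σ` the energy rate is nonnegative by the eigenvector relation and nonpositive by the
  -- Lyapunov equation, so both quadratic forms in `G` vanish.
  have h1 := energy_balance hP.transpose_eq ha hb
  have h2 : ∀ v, 2 * (v ⬝ᵥ P *ᵥ (M *ᵥ v)) = -(v ⬝ᵥ G *ᵥ v) := fun v => by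
    rw [← quad_lyapunov hP.transpose_eq, h, neg_mulVec, dotProduct_neg]
  have h3 := h2 a
  have h4 := h2 b
  have h5 := hG.quad_nonneg a
  have h6 := hG.quad_nonneg b
  have h7 := mul_nonneg hσ (add_nonneg (hP.quad_nonneg a) (hP.quad_nonneg b))
  exact hker σ ω a b ha hb (hG.mulVec_eq_zero (by linarith)) (hG.mulVec_eq_zero (by linarith))

/-- Observability of `(A, H)`: the unobservable subspace is trivial. -/
def IsObservablePair (A : Matrix ι ι ℝ) (H : Matrix κ ι ℝ) : Prop :=
  ∀ v, (∀ k : ℕ, H *ᵥ (A ^ k *ᵥ v) = 0) → v = 0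

omit [Fintype κ] in
-- Hautus test in real form: the span of `a` and `b` is invariant under `A` and lies in the kernel
-- of `H`.
lemma IsObservablePair.eigenvector_eq_zero {A : Matrix ι ι ℝ} {H : Matrix κ ι ℝ}
    (hobs : IsObservablePair A H) {σ ω : ℝ} {a b : ι → ℝ} (ha : A *ᵥ a = σ • a - ω • b)
    (hb : A *ᵥ b = ω • a + σ • b) (hHa : H *ᵥ a = 0) (hHb : H *ᵥ b = 0) : a = 0 ∧ b = 0 := by
  have key : ∀ k : ℕ, H *ᵥ (A ^ k *ᵥ a) = 0 ∧ H *ᵥ (A ^ k *ᵥ b) = 0 := by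
    intro k
    induction k with
    | zero => simpa using ⟨hHa, hHb⟩
    | succ k ih =>
      rw [pow_succ, ← mulVec_mulVec, ← mulVec_mulVec, ha, hb]
      simp [mulVec_sub, mulVec_add, mulVec_smul, ih.1, ih.2]
  exact ⟨hobs a fun k => (key k).1, hobs b fun k => (key k).2⟩

/-- The residual of the algebraic Riccati equation `Aᵀ X + X A - X W X + H = 0`. -/
def riccati (A W H X : Matrix ι ι ℝ) : Matrix ι ι ℝ := Aᵀ * X + X * A - X * W * X + H

variable {A W H X : Matrix ι ι ℝ}

omit [DecidableEq ι] in
lemma riccati_lyapunov (hW : Wᵀ = W) (hX : Xᵀ = X) :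
    (A - W * X)ᵀ * X + X * (A - W * X) = riccati A W H X - (H + X * W * X) := by
  rw [transpose_sub, transpose_mul, hW, hX, riccati]
  noncomm_ring

/-- LaSalle with storage `X`: where the dissipation `H + X W X - riccati A W H X` vanishes, so do `H
v` and `W X v`. The closed loop acts there as `A`, and observability applies. -/
lemma asymptoticallyStable_of_riccati (hW : W.PosSemidef) (hH : H.PosSemidef)
    (hobs : IsObservablePair A H) (hX : X.PosSemidef) (hric : (-riccati A W H X).PosSemidef) :
    AsymptoticallyStable (A - W * X) := by
  have hXWX : (X * W * X).PosSemidef := by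
    have := hW.transpose_mul_mul X
    rwa [hX.transpose_eq] at this
  have hker : ∀ v, (H + X * W * X + -riccati A W H X) *ᵥ v = 0 → H *ᵥ v = 0 ∧
      (A - W * X) *ᵥ v = A *ᵥ v := by
    intro v hv
    obtain ⟨h1, h2⟩ := (hH.add hXWX).mulVec_eq_zero_of_add hric hv
    obtain ⟨h3, h4⟩ := hH.mulVec_eq_zero_of_add hXWX h1
    refine ⟨h3, ?_⟩
    have h5 : W *ᵥ (X *ᵥ v) = 0 := hW.mulVec_eq_zero (by
      have := congrArg (v ⬝ᵥ ·) h4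
      simp only [dotProduct_zero] at this
      rw [← this, ← dotProduct_mulVec_transpose, hX.transpose_eq, mulVec_mulVec, mulVec_mulVec,
        Matrix.mul_assoc])
    rw [sub_mulVec, ← mulVec_mulVec, h5, sub_zero]
  refine asymptoticallyStable_of_lyapunov hX ((hH.add hXWX).add hric) ?_ ?_
  · rw [riccati_lyapunov (H := H) hW.transpose_eq hX.transpose_eq]
    abel
  · intro σ ω a b ha hb hGa hGb
    obtain ⟨ha1, ha2⟩ := hker a hGa
    obtain ⟨hb1, hb2⟩ := hker b hGb
    exact hobs.eigenvector_eq_zero (ha2 ▸ ha) (hb2 ▸ hb) ha1 hb1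

lemma posSemidef_of_riccati_stabilizing (hW : W.PosSemidef) (hH : H.PosSemidef) (hX : Xᵀ = X)
    (hric : riccati A W H X = 0) (hst : AsymptoticallyStable (A - W * X)) : X.PosSemidef := by
  refine posSemidef_of_lyapunov hst ?_
  rw [riccati_lyapunov (H := H) hW.transpose_eq hX, hric, zero_sub, neg_neg]
  have := hW.transpose_mul_mul X
  rw [hX] at this
  exact hH.add this

/-- The equation makes the kernel of `X` an `A`-invariant subspace of the kernel of `H`, hence
trivial. -/
lemma posDef_of_riccati (hH : H.PosSemidef) (hobs : IsObservablePair A H) (hX : X.PosSemidef)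
    (hric : riccati A W H X = 0) : X.PosDef := by
  have hker : ∀ v, X *ᵥ v = 0 → H *ᵥ v = 0 ∧ X *ᵥ (A *ᵥ v) = 0 := by
    intro v hv
    have h1 : X *ᵥ (A *ᵥ v) + H *ᵥ v = 0 := by
      have := congrArg (· *ᵥ v) hric
      simpa [riccati, add_mulVec, sub_mulVec, ← mulVec_mulVec, hv] using this
    have h2 : v ⬝ᵥ X *ᵥ (A *ᵥ v) = 0 := by
      rw [← hX.transpose_eq, dotProduct_mulVec_transpose, hv, zero_dotProduct]
    have h3 : H *ᵥ v = 0 := hH.mulVec_eq_zero (by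
      have := congrArg (v ⬝ᵥ ·) h1
      simpa only [dotProduct_add, h2, zero_add, dotProduct_zero] using this)
    exact ⟨h3, by simpa [h3] using h1⟩
  refine .of_dotProduct_mulVec_pos hX.1 fun v hv => ?_
  rw [star_trivial]
  refine lt_of_le_of_ne (hX.quad_nonneg v) fun h0 => hv ?_
  have hpow : ∀ k : ℕ, X *ᵥ (A ^ k *ᵥ v) = 0 := by
    intro k
    induction k with
    | zero => simpa using hX.mulVec_eq_zero h0.symm
    | succ k ih => rw [pow_succ', ← mulVec_mulVec]; exact (hker _ ih).2
  exact hobs v fun k => (hker _ (hpow k)).1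

/-- Uniqueness of the stabilizing solution of an algebraic Riccati equation. -/
lemma riccati_stabilizing_unique {Y : Matrix ι ι ℝ} (hW : Wᵀ = W) (hX : Xᵀ = X)
    (hrX : riccati A W H X = 0) (hrY : riccati A W H Y = 0)
    (hsX : AsymptoticallyStable (A - W * X)) (hsY : AsymptoticallyStable (A - W * Y)) :
    X = Y := by
  rw [← sub_eq_zero]
  refine eq_zero_of_sylvester hsX hsY ?_
  -- The cross terms `X W Y` cancel, so the difference of residuals is `(A - W X)ᵀ (X - Y) + (X - Y)
  -- (A - W Y)`.
  have : riccati A W H X - riccati A W H Y = 0 := by rw [hrX, hrY, sub_zero]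
  rw [← this, riccati, riccati, transpose_sub, transpose_mul, hW, hX]
  noncomm_ring

/-- One Newton step from a positive semidefinite supersolution. -/
lemma exists_newton_step (hW : W.PosSemidef) (hH : H.PosSemidef)
    (hobs : IsObservablePair A H) (hX : X.PosSemidef) (hric : (-riccati A W H X).PosSemidef) :
    ∃ D : Matrix ι ι ℝ, D.PosSemidef ∧ (X - D).PosSemidef ∧
      (-riccati A W H (X - D)).PosSemidef ∧
      (A - W * X)ᵀ * D + D * (A - W * X) = riccati A W H X := by
  have hst := asymptoticallyStable_of_riccati hW hH hobs hX hric
  obtain ⟨D, hD⟩ := exists_lyapunov hst (riccati A W H X)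
  have hD0 : D.PosSemidef := posSemidef_of_lyapunov hst (by rwa [hD])
  have hXWX : (X * W * X).PosSemidef := by
    have := hW.transpose_mul_mul X
    rwa [hX.transpose_eq] at this
  refine ⟨D, hD0, posSemidef_of_lyapunov hst ?_, ?_, hD⟩
  · have : -((A - W * X)ᵀ * (X - D) + (X - D) * (A - W * X)) = H + X * W * X := by
      calc _ = ((A - W * X)ᵀ * D + D * (A - W * X)) -
            ((A - W * X)ᵀ * X + X * (A - W * X)) := by noncomm_ring
        _ = _ := by
          rw [hD, riccati_lyapunov (H := H) hW.transpose_eq hX.transpose_eq]; abel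
    rw [this]
    exact hH.add hXWX
  -- The linear part of the residual is cancelled by the choice of `D`; only the quadratic remainder
  -- is left.
  · have : -riccati A W H (X - D) = Dᵀ * W * D := by
      calc _ = ((A - W * X)ᵀ * D + D * (A - W * X)) - riccati A W H X + D * W * D := by
            rw [riccati, riccati, transpose_sub, transpose_mul, hW.transpose_eq, hX.transpose_eq]
            noncomm_ring
        _ = _ := by rw [hD, hD0.transpose_eq]; abel
    rw [this]
    exact hW.transpose_mul_mul D

/-- Existence of a positive semidefinite solution of an algebraic Riccati equation below a
supersolution. -/
lemma exists_riccati_solution (hW : W.PosSemidef) (hH : H.PosSemidef)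
    (hobs : IsObservablePair A H) {X₀ : Matrix ι ι ℝ} (hX₀ : X₀.PosSemidef)
    (hric : (-riccati A W H X₀).PosSemidef) :
    ∃ X : Matrix ι ι ℝ, X.PosSemidef ∧ riccati A W H X = 0 := by
  have hcont : Continuous fun X : Matrix ι ι ℝ => -riccati A W H X := by
    unfold riccati; fun_prop
  have hK := (isCompact_posSemidef_trace_le X₀.trace).inter_right
    (isClosed_posSemidef.preimage hcont)
  obtain ⟨X, ⟨⟨hX, hXt⟩, hXr⟩, hmin⟩ := hK.exists_isMinOn ⟨X₀, ⟨hX₀, le_rfl⟩, hric⟩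
    (f := trace) (continuous_id.matrix_trace.continuousOn)
  -- A Newton step from the trace minimizer stays in the compact set and cannot lower the trace, so
  -- `D` has trace zero.
  obtain ⟨D, hD, hXD, hr, hlyap⟩ := exists_newton_step hW hH hobs hX hXr
  have htr : (X - D).trace = X.trace - D.trace := trace_sub _ _
  have hD1 := hD.trace_nonneg
  have hle : X.trace ≤ (X - D).trace := hmin ⟨⟨hXD, by rw [htr]; linarith⟩, hr⟩
  have hD2 : D = 0 := hD.trace_eq_zero_iff.1 (by linarith)
  exact ⟨X, hX, by rw [← hlyap, hD2]; simp⟩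

end Riccati

lemma mulVec_eq_zero_of_rank {ι : Type*} {n : ℕ} [Fintype ι] {M : Matrix ι (Fin n) ℝ}
    (h : M.rank = n) {v : Fin n → ℝ} (hv : M *ᵥ v = 0) : v = 0 := by
  have h1 := LinearMap.finrank_range_add_finrank_ker M.mulVecLin
  have h2 : Module.finrank ℝ (LinearMap.range M.mulVecLin) = n := h
  rw [h2, Module.finrank_fin_fun] at h1
  have h3 : LinearMap.ker M.mulVecLin = ⊥ := Submodule.finrank_eq_zero.1 (by omega)
  have h4 : v ∈ LinearMap.ker M.mulVecLin := hv
  simpa [h3] using h4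

lemma isObservablePair_of_rank {n p : ℕ} {A : Matrix (Fin n) (Fin n) ℝ}
    {C : Matrix (Fin p) (Fin n) ℝ} (h : (observabilityMatrix A C).rank = n) :
    IsObservablePair A C := by
  intro v hv
  refine mulVec_eq_zero_of_rank h ?_
  funext q
  have := congrFun (hv q.1) q.2
  rw [mulVec_mulVec] at this
  exact this

lemma AsymptoticallyStable.transpose {ι : Type*} [Fintype ι] [DecidableEq ι] {A : Matrix ι ι ℝ}
    (h : AsymptoticallyStable A) : AsymptoticallyStable Aᵀ := by
  intro z hz
  refine h z ?_
  rw [spectrum.mem_iff, Matrix.isUnit_iff_isUnit_det] at hz ⊢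
  rwa [← det_transpose, transpose_sub, ← transpose_map, Algebra.algebraMap_eq_smul_one,
    transpose_smul, transpose_one, ← Algebra.algebraMap_eq_smul_one]

/-! ### Port-Hamiltonian systems and the two modified Riccati equations -/

section PortHamiltonian

variable {n m : ℕ}

/-- A dissipation inequality and collocated output make a system port-Hamiltonian. -/
lemma isPortHamiltonianWith_of_dissipation {A X : Matrix (Fin n) (Fin n) ℝ}
    {B : Matrix (Fin n) (Fin m) ℝ} {C : Matrix (Fin m) (Fin n) ℝ} (hX : X.PosDef)
    (hdiss : (-(Aᵀ * X + X * A)).PosSemidef) (hC : C = Bᵀ * X) :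
    IsPortHamiltonianWith A B C X := by
  have hdet : IsUnit X.det := (Matrix.isUnit_iff_isUnit_det X).1 hX.isUnit
  have hXt := hX.posSemidef.transpose_eq
  have h1 : X⁻¹ * X = 1 := nonsing_inv_mul X hdet
  have h2 : X * X⁻¹ = 1 := mul_nonsing_inv X hdet
  have hXit : X⁻¹ᵀ = X⁻¹ := by rw [transpose_nonsing_inv, hXt]
  -- `J` and `-R` are the skew and symmetric parts of `A X⁻¹`; the dissipation inequality is moved
  -- to `R` by congruence with `X⁻¹`.
  have hR : (-(1 / 2 : ℝ) • (A * X⁻¹ + (A * X⁻¹)ᵀ)).PosSemidef := by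
    have := (hdiss.transpose_mul_mul X⁻¹).smul (show (0 : ℝ) ≤ 1 / 2 by norm_num)
    convert this using 1
    rw [hXit, transpose_mul, hXit]
    have : X⁻¹ * -(Aᵀ * X + X * A) * X⁻¹ = -(A * X⁻¹ + X⁻¹ * Aᵀ) := by
      calc _ = -(X⁻¹ * Aᵀ * (X * X⁻¹) + (X⁻¹ * X) * A * X⁻¹) := by noncomm_ring
        _ = _ := by rw [h1, h2, one_mul, mul_one, add_comm]
    rw [this, smul_neg, neg_smul]
  refine ⟨⟨(1 / 2 : ℝ) • (A * X⁻¹ - (A * X⁻¹)ᵀ), _, X, B, ?_, hR, hX⟩, rfl, ?_, rfl, hC.symm⟩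
  · rw [transpose_smul, transpose_sub, transpose_transpose, ← smul_neg, neg_sub]
  · simp only [PHSystem.A]
    have : (1 / 2 : ℝ) • (A * X⁻¹ - (A * X⁻¹)ᵀ) - -(1 / 2 : ℝ) • (A * X⁻¹ + (A * X⁻¹)ᵀ)
        = A * X⁻¹ := by
      module
    rw [this, Matrix.mul_assoc, h1, Matrix.mul_one]

/-- Uniqueness of the stabilizing solution of the filter equation. -/
lemma IsStabilizingFilterSolution.unique {γ : ℝ} {A R Y Y' : Matrix (Fin n) (Fin n) ℝ}
    {B : Matrix (Fin n) (Fin m) ℝ} {C : Matrix (Fin m) (Fin n) ℝ}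
    (h : IsStabilizingFilterSolution γ A R B C Y) (h' : IsStabilizingFilterSolution γ A R B C Y') :
    Y = Y' := by
  -- By duality the filter equation is a Riccati equation for `Aᵀ`.
  have key : ∀ Z, IsStabilizingFilterSolution γ A R B C Z →
      riccati Aᵀ ((1 - (γ ^ 2)⁻¹) • (Cᵀ * C)) ((1 - (γ ^ 2)⁻¹) • (B * Bᵀ) + (2 : ℝ) • R) Z = 0 ∧
      AsymptoticallyStable (Aᵀ - (1 - (γ ^ 2)⁻¹) • (Cᵀ * C) * Z) := by
    rintro Z ⟨hZ, hr, hs⟩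
    constructor
    · rw [← hr, riccati, transpose_transpose]
      simp only [Matrix.mul_smul, Matrix.smul_mul, Matrix.mul_assoc, add_assoc]
    · have := hs.transpose
      rwa [transpose_sub, transpose_smul, transpose_mul, transpose_mul, transpose_transpose,
        hZ.eq, ← Matrix.mul_assoc, ← Matrix.smul_mul] at this
  refine riccati_stabilizing_unique ?_ h.1.eq (key Y h).1 (key Y' h').1 (key Y h).2 (key Y' h').2
  rw [transpose_smul, transpose_mul, transpose_transpose]

namespace PHSystem

variable (S : PHSystem n m)

lemma Q_transpose : S.Qᵀ = S.Q := S.Q_posDef.posSemidef.transpose_eq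

lemma R_transpose : S.Rᵀ = S.R := S.R_posSemidef.transpose_eq

lemma C_transpose : S.Cᵀ = S.Q * S.B := by
  rw [C, transpose_mul, transpose_transpose, Q_transpose]

lemma isUnit_det_Q : IsUnit S.Q.det := (Matrix.isUnit_iff_isUnit_det _).1 S.Q_posDef.isUnit

lemma inv_Q_mul_C_transpose : S.Q⁻¹ * S.Cᵀ = S.B := by
  rw [C_transpose, ← Matrix.mul_assoc, nonsing_inv_mul _ S.isUnit_det_Q, Matrix.one_mul]

lemma A_mul_inv_Q : S.A * S.Q⁻¹ = S.J - S.R := by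
  rw [A, Matrix.mul_assoc, mul_nonsing_inv _ S.isUnit_det_Q, Matrix.mul_one]

lemma C_mul_inv_Q : S.C * S.Q⁻¹ = S.Bᵀ := by
  rw [C, Matrix.mul_assoc, mul_nonsing_inv _ S.isUnit_det_Q, Matrix.mul_one]

lemma inv_Q_transpose : S.Q⁻¹ᵀ = S.Q⁻¹ := by rw [transpose_nonsing_inv, Q_transpose]

lemma lyapunov_Q : S.Aᵀ * S.Q + S.Q * S.A = -((2 : ℝ) • (S.Q * S.R * S.Q)) := by
  rw [A, transpose_mul, transpose_sub, S.J_skew, R_transpose, Q_transpose, two_smul]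
  noncomm_ring

lemma posSemidef_QRQ : (S.Q * S.R * S.Q).PosSemidef := by
  have := S.R_posSemidef.transpose_mul_mul S.Q
  rwa [Q_transpose] at this

lemma lyapunov_Q_output (c : ℝ) :
    (S.A + c • (S.B * S.C))ᵀ * S.Q + S.Q * (S.A + c • (S.B * S.C)) =
      -((2 : ℝ) • (S.Q * S.R * S.Q)) + (2 * c) • (S.Cᵀ * S.C) := by
  have h : S.Bᵀ * S.Q = S.C := rfl
  rw [← lyapunov_Q, transpose_add, transpose_smul, transpose_mul, add_mul, mul_add, mul_smul,
    two_smul, Matrix.smul_mul, Matrix.mul_smul, Matrix.mul_assoc S.Cᵀ, h, ← Matrix.mul_assoc S.Q,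
    ← C_transpose]
  abel

variable {S}

/-- Output damping stabilizes an observable port-Hamiltonian system. -/
lemma asymptoticallyStable_output_damping (hobs : IsObservablePair S.A S.C) {c : ℝ} (hc : 0 < c) :
    AsymptoticallyStable (S.A - c • (S.B * S.C)) := by
  have h1 := S.posSemidef_QRQ.smul (zero_le_two (α := ℝ))
  have h2 := (posSemidef_transpose_mul S.C).smul (mul_pos two_pos hc).le
  have hker : ∀ v, ((2 : ℝ) • (S.Q * S.R * S.Q) + (2 * c) • (S.Cᵀ * S.C)) *ᵥ v = 0 →
      S.C *ᵥ v = 0 ∧ (S.A - c • (S.B * S.C)) *ᵥ v = S.A *ᵥ v := by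
    intro v hv
    have h3 := (h1.mulVec_eq_zero_of_add h2 hv).2
    rw [smul_mulVec, smul_eq_zero_iff_right (by positivity)] at h3
    have h4 := transpose_mul_mulVec_eq_zero h3
    exact ⟨h4, by rw [sub_mulVec, smul_mulVec, ← mulVec_mulVec, h4]; simp⟩
  refine asymptoticallyStable_of_lyapunov S.Q_posDef.posSemidef (h1.add h2) ?_ ?_
  · rw [sub_eq_add_neg, ← neg_smul, lyapunov_Q_output]
    module
  · intro σ ω a b ha hb hGa hGb
    obtain ⟨ha1, ha2⟩ := hker a hGa
    obtain ⟨hb1, hb2⟩ := hker b hGb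
    exact hobs.eigenvector_eq_zero (ha2 ▸ ha) (hb2 ▸ hb) ha1 hb1

/-- Along a trajectory with zero output, the injected term `c B C` is zero. -/
lemma isObservablePair_output_injection (hobs : IsObservablePair S.A S.C) (c : ℝ) :
    IsObservablePair (S.A + c • (S.B * S.C)) (S.Cᵀ * S.C) := by
  intro v hv
  have key : ∀ k : ℕ, (S.A + c • (S.B * S.C)) ^ k *ᵥ v = S.A ^ k *ᵥ v := by
    intro k
    induction k with
    | zero => simp
    | succ k ih =>
      have h := transpose_mul_mulVec_eq_zero (hv k)
      rw [pow_succ', ← mulVec_mulVec, add_mulVec, smul_mulVec, ← mulVec_mulVec, h, ih, pow_succ',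
        ← mulVec_mulVec]
      simp
  exact hobs v fun k => by rw [← key]; exact transpose_mul_mulVec_eq_zero (hv k)

lemma isStabilizingFilterSolution_inv_Q (hobs : IsObservablePair S.A S.C) {γ : ℝ} (hγ : 1 < γ) :
    IsStabilizingFilterSolution γ S.A S.R S.B S.C S.Q⁻¹ := by
  have hb : 0 < 1 - (γ ^ 2)⁻¹ := sub_pos.2 (inv_lt_one_of_one_lt₀ (one_lt_pow₀ hγ two_ne_zero))
  refine ⟨S.inv_Q_transpose, ?_, ?_⟩
  · have h : S.Q⁻¹ * S.Aᵀ = (S.A * S.Q⁻¹)ᵀ := by rw [transpose_mul, inv_Q_transpose]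
    rw [h, A_mul_inv_Q, inv_Q_mul_C_transpose, Matrix.mul_assoc, C_mul_inv_Q, transpose_sub,
      S.J_skew, R_transpose, two_smul]
    abel
  · rw [inv_Q_mul_C_transpose]
    exact asymptoticallyStable_output_damping hobs hb

lemma isStabilizingControlSolution_inv_Q_iff {γ : ℝ} {X : Matrix (Fin n) (Fin n) ℝ} :
    IsStabilizingControlSolution γ S.A S.B S.C S.Q⁻¹ X ↔ Xᵀ = X ∧
      riccati (S.A + (γ ^ 2)⁻¹ • (S.B * S.C)) ((1 - (γ ^ 2)⁻¹) • (S.B * S.Bᵀ)) (S.Cᵀ * S.C) X = 0 ∧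
      AsymptoticallyStable
        (S.A + (γ ^ 2)⁻¹ • (S.B * S.C) - (1 - (γ ^ 2)⁻¹) • (S.B * S.Bᵀ) * X) := by
  rw [IsStabilizingControlSolution, inv_Q_mul_C_transpose, riccati]
  simp only [Matrix.mul_smul, Matrix.smul_mul, Matrix.mul_assoc, IsSymm]

lemma posDef_of_control_riccati (hobs : IsObservablePair S.A S.C) {g b : ℝ} (hb : 0 ≤ b)
    {X : Matrix (Fin n) (Fin n) ℝ} (hX : Xᵀ = X)
    (hr : riccati (S.A + g • (S.B * S.C)) (b • (S.B * S.Bᵀ)) (S.Cᵀ * S.C) X = 0)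
    (hs : AsymptoticallyStable (S.A + g • (S.B * S.C) - b • (S.B * S.Bᵀ) * X)) : X.PosDef :=
  posDef_of_riccati (posSemidef_transpose_mul _) (isObservablePair_output_injection hobs g)
    (posSemidef_of_riccati_stabilizing ((posSemidef_mul_transpose _).smul hb)
      (posSemidef_transpose_mul _) hX hr hs) hr

/-- A large multiple of the Hamiltonian is a supersolution of the control equation. -/
lemma exists_control_supersolution {g : ℝ} (hg0 : 0 ≤ g) (hg1 : g < 1) :
    ∃ X₀ : Matrix (Fin n) (Fin n) ℝ, X₀.PosSemidef ∧
      (-riccati (S.A + g • (S.B * S.C)) ((1 - g) • (S.B * S.Bᵀ)) (S.Cᵀ * S.C) X₀).PosSemidef := by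
  have hb : 0 < 1 - g := sub_pos.2 hg1
  -- For `c Q` the coefficient of `Cᵀ C` in the negated residual is `(1 - g) c² - 2 g c - 1`. With
  -- `(1 - g) c = 3` it is `c (3 - 2 g) - 1`, which is positive since `g < 1` and `c ≥ 3`.
  set c : ℝ := 3 / (1 - g) with hc
  have hbc : (1 - g) * c = 3 := by rw [hc]; field_simp
  have hc3 : 3 ≤ c := by rw [hc, le_div_iff₀ hb]; linarith
  have hc0 : 0 ≤ c := by linarith
  refine ⟨c • S.Q, S.Q_posDef.posSemidef.smul hc0, ?_⟩
  have hlyap := S.lyapunov_Q_output g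
  have hQ : S.Q * (S.B * S.Bᵀ) * S.Q = S.Cᵀ * S.C := by
    rw [C_transpose, C]; simp only [Matrix.mul_assoc]
  have : -riccati (S.A + g • (S.B * S.C)) ((1 - g) • (S.B * S.Bᵀ)) (S.Cᵀ * S.C) (c • S.Q) =
      (2 * c) • (S.Q * S.R * S.Q) + (c * (3 - 2 * g) - 1) • (S.Cᵀ * S.C) := by
    rw [riccati, Matrix.mul_smul, Matrix.smul_mul c, ← smul_add, hlyap, Matrix.smul_mul,
      Matrix.mul_smul, Matrix.mul_smul, Matrix.smul_mul, Matrix.smul_mul, hQ, ← hbc]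
    module
  rw [this]
  exact (S.posSemidef_QRQ.smul (by positivity)).add
    ((posSemidef_transpose_mul _).smul (by nlinarith))

lemma existsUnique_control_solution (hobs : IsObservablePair S.A S.C) {γ : ℝ} (hγ : 1 < γ) :
    ∃! X, IsStabilizingControlSolution γ S.A S.B S.C S.Q⁻¹ X := by
  have hg1 : (γ ^ 2)⁻¹ < 1 := inv_lt_one_of_one_lt₀ (one_lt_pow₀ hγ two_ne_zero)
  have hW : ((1 - (γ ^ 2)⁻¹) • (S.B * S.Bᵀ)).PosSemidef :=
    (posSemidef_mul_transpose _).smul (sub_pos.2 hg1).le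
  have hH := posSemidef_transpose_mul S.C
  have hobs' := isObservablePair_output_injection hobs (γ ^ 2)⁻¹
  obtain ⟨X₀, hX₀, hr₀⟩ := S.exists_control_supersolution (by positivity) hg1
  obtain ⟨X, hX, hr⟩ := exists_riccati_solution hW hH hobs' hX₀ hr₀
  have hX' := isStabilizingControlSolution_inv_Q_iff.2 ⟨hX.transpose_eq, hr,
    asymptoticallyStable_of_riccati hW hH hobs' hX (by rw [hr, neg_zero]; exact .zero)⟩
  refine ⟨X, hX', fun Z hZ => ?_⟩
  obtain ⟨h1, h2, h3⟩ := isStabilizingControlSolution_inv_Q_iff.1 hZ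
  obtain ⟨-, h5, h6⟩ := isStabilizingControlSolution_inv_Q_iff.1 hX'
  exact riccati_stabilizing_unique hW.transpose_eq h1 h2 h5 h3 h6

/-- The controller dissipates the energy given by the solution of the control equation. -/
lemma controller_dissipation {g : ℝ} (hg : 0 ≤ g) {X : Matrix (Fin n) (Fin n) ℝ} (hX : Xᵀ = X)
    (hr : riccati (S.A + g • (S.B * S.C)) ((1 - g) • (S.B * S.Bᵀ)) (S.Cᵀ * S.C) X = 0) :
    (-((S.A - (1 - g) • (S.B * S.C) - S.B * S.Bᵀ * X)ᵀ * X +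
      X * (S.A - (1 - g) • (S.B * S.C) - S.B * S.Bᵀ * X))).PosSemidef := by
  -- After elimination of the Riccati equation, `Cᵀ C = Q B Bᵀ Q` and the cross terms complete this
  -- square; `g X B Bᵀ X` is left over.
  have h1 := posSemidef_mul_transpose (X * S.B + S.Q * S.B)
  have h2 := (posSemidef_mul_transpose (X * S.B)).smul hg
  have hAhat : S.A - (1 - g) • (S.B * S.C) - S.B * S.Bᵀ * X =
      S.A + g • (S.B * S.C) - S.B * S.C - S.B * S.Bᵀ * X := by module
  convert h1.add h2 using 1
  rw [hAhat, ← add_zero (-_), ← hr, riccati, transpose_sub, transpose_sub, transpose_mul S.B,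
    C_transpose, C]
  generalize S.A + g • (S.B * (S.Bᵀ * S.Q)) = A'
  simp only [transpose_mul, transpose_add, hX, Q_transpose, transpose_transpose, sub_smul,
    one_smul, Matrix.mul_sub, Matrix.sub_mul, Matrix.mul_add, Matrix.add_mul, Matrix.mul_smul,
    Matrix.smul_mul, Matrix.mul_assoc]
  abel

end PHSystem

end PortHamiltonian

/-! ### Frequency-domain criterion for the norm bound -/

section HInfNorm

variable {ι κ κ' : Type*} [Fintype ι] [DecidableEq ι] [Fintype κ] [DecidableEq κ] [Fintype κ']

omit [DecidableEq κ] in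
lemma sum_norm_sq_eq_dotProduct (v : κ → ℂ) :
    ∑ i, ‖v i‖ ^ 2 = (fun i => (v i).re) ⬝ᵥ (fun i => (v i).re) +
      (fun i => (v i).im) ⬝ᵥ (fun i => (v i).im) := by
  rw [dotProduct, dotProduct, ← Finset.sum_add_distrib]
  exact Finset.sum_congr rfl fun i _ => by rw [Complex.sq_norm, Complex.normSq_apply]

open scoped Matrix.Norms.L2Operator in
-- The inequality stays strict because the operator norm is attained on the compact unit ball.
lemma l2_opNorm_lt_of_forall {T : Matrix κ' κ ℂ} {γ : ℝ} (hγ : 0 < γ)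
    (h : ∀ w ≠ 0, ∑ i, ‖(T *ᵥ w) i‖ ^ 2 < γ ^ 2 * ∑ j, ‖w j‖ ^ 2) : ‖T‖ < γ := by
  rw [l2_opNorm_def]
  set f := (toEuclideanLin (𝕜 := ℂ) (m := κ') (n := κ)).trans LinearMap.toContinuousLinearMap T
    with hf
  obtain ⟨x, hx, hfx⟩ := (isCompact_closedBall (0 : EuclideanSpace ℂ κ) 1).exists_sSup_image_eq
    ⟨0, by simp⟩ (f := fun x => ‖f x‖) (by fun_prop)
  rw [f.sSup_unitClosedBall_eq_norm] at hfx
  rw [hfx]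
  rcases eq_or_ne x 0 with rfl | hx0
  · simpa using hγ
  have hx1 : ‖x‖ ≤ 1 := by simpa using hx
  have h1 := h x.ofLp (by simpa using hx0)
  rw [← EuclideanSpace.norm_sq_eq x] at h1
  have h2 : ‖f x‖ ^ 2 = ∑ i, ‖(T *ᵥ x.ofLp) i‖ ^ 2 := EuclideanSpace.norm_sq_eq (f x)
  rw [← h2] at h1
  refine lt_of_pow_lt_pow_left₀ 2 hγ.le (h1.trans_le ?_)
  have : ‖x‖ ^ 2 ≤ 1 := pow_le_one₀ (norm_nonneg _) hx1
  nlinarith [sq_nonneg γ]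

omit [Fintype κ] [DecidableEq κ] [Fintype κ'] in
lemma transferFunction_eq_resolvent (A : Matrix ι ι ℝ) (D : Matrix ι κ ℝ) (E : Matrix κ' ι ℝ)
    (s : ℂ) : transferFunction A D E s =
      E.map Complex.ofReal * resolvent (A.map Complex.ofReal) s * D.map Complex.ofReal := by
  rw [transferFunction, resolvent, nonsing_inv_eq_ringInverse, Algebra.algebraMap_eq_smul_one]

lemma AsymptoticallyStable.mem_resolventSet {A : Matrix ι ι ℝ} (hA : AsymptoticallyStable A)
    (ω : ℝ) : (ω : ℂ) * Complex.I ∈ resolventSet ℂ (A.map Complex.ofReal) := by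
  by_contra h
  have := hA _ h
  simp at this

section
open scoped Matrix.Norms.L2Operator

lemma continuous_norm_transferFunction {A : Matrix ι ι ℝ} (hA : AsymptoticallyStable A)
    (D : Matrix ι κ ℝ) (E : Matrix κ' ι ℝ) :
    Continuous fun ω : ℝ => ‖transferFunction A D E ((ω : ℂ) * Complex.I)‖ := by
  have h : Continuous fun ω : ℝ => resolvent (A.map Complex.ofReal) ((ω : ℂ) * Complex.I) :=
    continuous_iff_continuousAt.2 fun ω => ContinuousAt.comp
      (f := fun ω : ℝ => (ω : ℂ) * Complex.I)
      (spectrum.hasDerivAt_resolvent_const_left (hA.mem_resolventSet ω)).continuousAt (by fun_prop)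
  simp only [transferFunction_eq_resolvent]
  exact ((continuous_const.matrix_mul h).matrix_mul continuous_const).norm

lemma tendsto_norm_transferFunction (A : Matrix ι ι ℝ) (D : Matrix ι κ ℝ) (E : Matrix κ' ι ℝ) :
    Tendsto (fun ω : ℝ => ‖transferFunction A D E ((ω : ℂ) * Complex.I)‖) (cocompact ℝ) (𝓝 0) := by
  have h1 : Tendsto (fun ω : ℝ => (ω : ℂ) * Complex.I) (cocompact ℝ) (Bornology.cobounded ℂ) := by
    rw [← tendsto_norm_atTop_iff_cobounded]
    simp only [norm_mul, Complex.norm_I, mul_one, Complex.norm_real]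
    exact tendsto_norm_cocompact_atTop
  have h2 := (spectrum.resolvent_tendsto_cobounded (𝕜 := ℂ) (A.map Complex.ofReal)).comp h1
  have hc : Continuous fun X : Matrix ι ι ℂ =>
      ‖E.map Complex.ofReal * X * D.map Complex.ofReal‖ :=
    ((continuous_const.matrix_mul continuous_id).matrix_mul continuous_const).norm
  have h3 := (hc.tendsto 0).comp h2
  simp only [Matrix.mul_zero, Matrix.zero_mul, norm_zero] at h3
  simp only [transferFunction_eq_resolvent]
  exact h3

/-- A continuous nonnegative function vanishing at infinity either is identically zero or attains
its maximum, so the supremum is again below `γ`. -/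
lemma hInfNorm_lt_of_forall_norm_lt {A : Matrix ι ι ℝ} (hA : AsymptoticallyStable A)
    (D : Matrix ι κ ℝ) (E : Matrix κ' ι ℝ) {γ : ℝ}
    (h : ∀ ω : ℝ, ‖transferFunction A D E ((ω : ℂ) * Complex.I)‖ < γ) :
    hInfNorm (transferFunction A D E) < ENNReal.ofReal γ := by
  have hγ : 0 < γ := (norm_nonneg _).trans_lt (h 0)
  have hmax : ∃ c < γ, ∀ ω : ℝ, ‖transferFunction A D E ((ω : ℂ) * Complex.I)‖ ≤ c := by
    by_cases hpos : ∃ ω₁ : ℝ, 0 < ‖transferFunction A D E ((ω₁ : ℂ) * Complex.I)‖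
    · obtain ⟨ω₁, h₁⟩ := hpos
      obtain ⟨ω₀, h₀⟩ := (continuous_norm_transferFunction hA D E).exists_forall_ge' ω₁
        (((tendsto_norm_transferFunction A D E).eventually (gt_mem_nhds h₁)).mono
          fun ω hω => hω.le)
      exact ⟨_, h ω₀, h₀⟩
    · push Not at hpos
      exact ⟨0, hγ, hpos⟩
  obtain ⟨c, hc, hle⟩ := hmax
  exact (iSup_le fun ω => ENNReal.ofReal_le_ofReal (hle ω)).trans_lt
    ((ENNReal.ofReal_lt_ofReal_iff hγ).2 hc)

/-- Frequency-domain criterion for the `H∞` norm, in terms of the real and imaginary parts of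
the phasors of the state and of the disturbance. -/
lemma hInfNorm_lt_of_phasor {A : Matrix ι ι ℝ} (hA : AsymptoticallyStable A)
    {D : Matrix ι κ ℝ} {E : Matrix κ' ι ℝ} {γ : ℝ} (hγ : 0 < γ)
    (h : ∀ (ω : ℝ) (x₁ x₂ : ι → ℝ) (w₁ w₂ : κ → ℝ), ¬(w₁ = 0 ∧ w₂ = 0) →
      A *ᵥ x₁ + D *ᵥ w₁ = -(ω • x₂) → A *ᵥ x₂ + D *ᵥ w₂ = ω • x₁ →
      (E *ᵥ x₁) ⬝ᵥ (E *ᵥ x₁) + (E *ᵥ x₂) ⬝ᵥ (E *ᵥ x₂) < γ ^ 2 * (w₁ ⬝ᵥ w₁ + w₂ ⬝ᵥ w₂)) :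
    hInfNorm (transferFunction A D E) < ENNReal.ofReal γ := by
  refine hInfNorm_lt_of_forall_norm_lt hA D E fun ω => l2_opNorm_lt_of_forall hγ fun w hw => ?_
  set s : ℂ := (ω : ℂ) * Complex.I with hs
  set x : ι → ℂ :=
    (s • (1 : Matrix ι ι ℂ) - A.map Complex.ofReal)⁻¹ *ᵥ (D.map Complex.ofReal *ᵥ w) with hx
  have hdet : IsUnit (s • (1 : Matrix ι ι ℂ) - A.map Complex.ofReal).det := by
    rw [← Matrix.isUnit_iff_isUnit_det, ← Algebra.algebraMap_eq_smul_one]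
    exact hA.mem_resolventSet ω
  have hstate : A.map Complex.ofReal *ᵥ x + D.map Complex.ofReal *ᵥ w = s • x := by
    have h1 : (s • (1 : Matrix ι ι ℂ) - A.map Complex.ofReal) *ᵥ x = D.map Complex.ofReal *ᵥ w := by
      rw [hx, mulVec_mulVec, mul_nonsing_inv _ hdet, one_mulVec]
    rw [← h1, sub_mulVec, smul_mulVec, one_mulVec, add_sub_cancel]
  have hT : transferFunction A D E s *ᵥ w = E.map Complex.ofReal *ᵥ x := by
    rw [transferFunction, ← mulVec_mulVec, ← mulVec_mulVec]
  rw [hT, sum_norm_sq_eq_dotProduct, sum_norm_sq_eq_dotProduct]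
  simp only [re_map_ofReal_mulVec, im_map_ofReal_mulVec]
  refine h ω _ _ _ _ ?_ ?_ ?_
  · rintro ⟨h1, h2⟩
    exact hw (funext fun i => Complex.ext (congrFun h1 i) (congrFun h2 i))
  · funext i
    have := congrArg Complex.re (congrFun hstate i)
    simpa [re_map_ofReal_mulVec, hs] using this
  · funext i
    have := congrArg Complex.im (congrFun hstate i)
    simpa [im_map_ofReal_mulVec, hs] using this

end

end HInfNorm

/-! ### Closed-loop stability and the dissipation argument -/

namespace PHSystem

variable {n m l : ℕ} {S : PHSystem n m}

lemma quad_QA (v : Fin n → ℝ) : v ⬝ᵥ S.Q *ᵥ (S.A *ᵥ v) = -(v ⬝ᵥ (S.Q * S.R * S.Q) *ᵥ v) := by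
  have := quad_lyapunov (M := S.A) S.Q_transpose v
  rw [lyapunov_Q, neg_mulVec, smul_mulVec, dotProduct_neg, dotProduct_smul, smul_eq_mul] at this
  linarith

lemma quad_QB (v : Fin n → ℝ) (u : Fin m → ℝ) : v ⬝ᵥ S.Q *ᵥ (S.B *ᵥ u) = (S.C *ᵥ v) ⬝ᵥ u := by
  rw [mulVec_mulVec, ← C_transpose, dotProduct_mulVec_transpose]

/-- The closed loop is asymptotically stable when the controller is strictly passive with storage
function `P`. -/
lemma asymptoticallyStable_closedLoop (hobs : IsObservablePair S.A S.C) (hB : S.B.rank = m)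
    {A' P G : Matrix (Fin n) (Fin n) ℝ} {C' : Matrix (Fin m) (Fin n) ℝ} (hP : P.PosDef)
    (hG : G.PosDef) (hA' : A'ᵀ * P + P * A' = -G) (hC' : C' = S.Bᵀ * P) :
    AsymptoticallyStable (closedLoopA S.A S.B S.C A' S.B C') := by
  refine asymptoticallyStable_iff.2 fun σ ω a b ha hb hσ => ?_
  obtain ⟨a₁, a₂, rfl⟩ : ∃ a₁ a₂, a = Sum.elim a₁ a₂ := ⟨_, _, (Sum.elim_comp_inl_inr a).symm⟩
  obtain ⟨b₁, b₂, rfl⟩ : ∃ b₁ b₂, b = Sum.elim b₁ b₂ := ⟨_, _, (Sum.elim_comp_inl_inr b).symm⟩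
  have split : ∀ x y u v : Fin n → ℝ, closedLoopA S.A S.B S.C A' S.B C' *ᵥ Sum.elim x y =
      Sum.elim u v → S.A *ᵥ x - S.B *ᵥ (C' *ᵥ y) = u ∧ S.B *ᵥ (S.C *ᵥ x) + A' *ᵥ y = v := by
    intro x y u v h
    rw [closedLoopA, fromBlocks_mulVec, Sum.elim_comp_inl, Sum.elim_comp_inr, neg_mulVec,
      ← sub_eq_add_neg, ← mulVec_mulVec, ← mulVec_mulVec] at h
    exact ⟨congrArg (· ∘ Sum.inl) h, congrArg (· ∘ Sum.inr) h⟩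
  obtain ⟨ha₁, ha₂⟩ := split a₁ a₂ (σ • a₁ - ω • b₁) (σ • a₂ - ω • b₂) (by
    rw [ha]; funext i; cases i <;> rfl)
  obtain ⟨hb₁, hb₂⟩ := split b₁ b₂ (ω • a₁ + σ • b₁) (ω • a₂ + σ • b₂) (by
    rw [hb]; funext i; cases i <;> rfl)
  have hPt := hP.posSemidef.transpose_eq
  -- The interconnection conserves power: as `C' = Bᵀ P`, the two coupling terms cancel.
  have power : ∀ x y : Fin n → ℝ, x ⬝ᵥ S.Q *ᵥ (S.A *ᵥ x - S.B *ᵥ (C' *ᵥ y)) +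
      y ⬝ᵥ P *ᵥ (S.B *ᵥ (S.C *ᵥ x) + A' *ᵥ y) =
      -(x ⬝ᵥ (S.Q * S.R * S.Q) *ᵥ x) - (1 / 2) * (y ⬝ᵥ G *ᵥ y) := by
    intro x y
    have h1 := quad_lyapunov (M := A') hPt y
    rw [hA', neg_mulVec, dotProduct_neg] at h1
    have h2 : y ⬝ᵥ P *ᵥ (S.B *ᵥ (S.C *ᵥ x)) = (S.C *ᵥ x) ⬝ᵥ (C' *ᵥ y) := by
      rw [mulVec_mulVec, dotProduct_comm (S.C *ᵥ x), ← dotProduct_mulVec_transpose, hC',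
        transpose_mul, transpose_transpose, hPt]
    rw [mulVec_sub, mulVec_add, dotProduct_sub, dotProduct_add, quad_QA, quad_QB, h2]
    linarith
  have h1 := energy_balance S.Q_transpose ha₁ hb₁
  have h2 := energy_balance hPt ha₂ hb₂
  have h3 := power a₁ a₂
  have h4 := power b₁ b₂
  have hQ := S.Q_posDef.posSemidef
  have h5 := mul_nonneg hσ (add_nonneg (hQ.quad_nonneg a₁) (hQ.quad_nonneg b₁))
  have h6 := mul_nonneg hσ (add_nonneg (hP.posSemidef.quad_nonneg a₂)
    (hP.posSemidef.quad_nonneg b₂))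
  have h7 := S.posSemidef_QRQ.quad_nonneg a₁
  have h8 := S.posSemidef_QRQ.quad_nonneg b₁
  have h9 := hG.posSemidef.quad_nonneg a₂
  have h10 := hG.posSemidef.quad_nonneg b₂
  have hzero : ∀ v : Fin n → ℝ, v ⬝ᵥ G *ᵥ v ≤ 0 → v = 0 := by
    intro v hv
    by_contra hne
    have := hG.dotProduct_mulVec_pos hne
    rw [star_trivial] at this
    linarith
  -- Strict dissipation removes the controller component. The second block row then reads `B C a₁ =
  -- 0`, and full column rank of `B` gives `C a₁ = 0`.
  obtain rfl : a₂ = 0 := hzero a₂ (by linarith)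
  obtain rfl : b₂ = 0 := hzero b₂ (by linarith)
  have hCa : S.C *ᵥ a₁ = 0 := mulVec_eq_zero_of_rank hB (by simpa using ha₂)
  have hCb : S.C *ᵥ b₁ = 0 := mulVec_eq_zero_of_rank hB (by simpa using hb₂)
  obtain ⟨rfl, rfl⟩ := hobs.eigenvector_eq_zero (by simpa using ha₁) (by simpa using hb₁) hCa hCb
  exact ⟨Sum.elim_zero_zero, Sum.elim_zero_zero⟩

section WorstCase

variable {g : ℝ} {X : Matrix (Fin n) (Fin n) ℝ} {D₁ : Matrix (Fin n) (Fin l) ℝ}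
  {D₂ : Matrix (Fin m) (Fin l) ℝ} {E₁ : Matrix (Fin l) (Fin n) ℝ} {E₂ : Matrix (Fin l) (Fin m) ℝ}

/-- The worst-case disturbance for estimation error `e` and controller state `y`. -/
def worstDisturbance (S : PHSystem n m) (g : ℝ) (X : Matrix (Fin n) (Fin n) ℝ)
    (D₁ : Matrix (Fin n) (Fin l) ℝ) (D₂ : Matrix (Fin m) (Fin l) ℝ) (e y : Fin n → ℝ) :
    Fin l → ℝ :=
  D₁ᵀ *ᵥ (S.Q *ᵥ e) - D₂ᵀ *ᵥ (S.C *ᵥ e) + g • D₂ᵀ *ᵥ (S.Bᵀ *ᵥ (X *ᵥ y))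

lemma mulVec_worstDisturbance_left
    (hD₁ : D₁ * D₁ᵀ = (2 : ℝ) • S.R + (1 - g) • (S.B * S.Bᵀ)) (hD₁₂ : D₁ * D₂ᵀ = 0)
    (e y : Fin n → ℝ) : D₁ *ᵥ S.worstDisturbance g X D₁ D₂ e y =
      (2 : ℝ) • S.R *ᵥ (S.Q *ᵥ e) + (1 - g) • S.B *ᵥ (S.C *ᵥ e) := by
  rw [worstDisturbance, mulVec_add, mulVec_sub, mulVec_smul, mulVec_mulVec _ D₁ D₁ᵀ,
    mulVec_mulVec _ D₁ D₂ᵀ, mulVec_mulVec _ D₁ D₂ᵀ, hD₁, hD₁₂, add_mulVec, smul_mulVec,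
    smul_mulVec, ← mulVec_mulVec _ S.B, mulVec_mulVec _ S.Bᵀ S.Q]
  simp [C]

lemma mulVec_worstDisturbance_right (hD₂ : D₂ * D₂ᵀ = 1) (hD₁₂ : D₁ * D₂ᵀ = 0)
    (e y : Fin n → ℝ) : D₂ *ᵥ S.worstDisturbance g X D₁ D₂ e y =
      -(S.C *ᵥ e) + g • S.Bᵀ *ᵥ (X *ᵥ y) := by
  have h : D₂ * D₁ᵀ = 0 := by rw [← transpose_transpose D₂, ← transpose_mul, hD₁₂, transpose_zero]
  rw [worstDisturbance, mulVec_add, mulVec_sub, mulVec_smul, mulVec_mulVec _ D₂ D₁ᵀ,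
    mulVec_mulVec _ D₂ D₂ᵀ, mulVec_mulVec _ D₂ D₂ᵀ, hD₂, h]
  simp

lemma dotProduct_worstDisturbance (e y : Fin n → ℝ) (w : Fin l → ℝ) :
    S.worstDisturbance g X D₁ D₂ e y ⬝ᵥ w = e ⬝ᵥ S.Q *ᵥ (D₁ *ᵥ w) - (S.C *ᵥ e) ⬝ᵥ (D₂ *ᵥ w) +
      g * ((S.Bᵀ *ᵥ (X *ᵥ y)) ⬝ᵥ (D₂ *ᵥ w)) := by
  have h1 : (D₁ᵀ *ᵥ (S.Q *ᵥ e)) ⬝ᵥ w = e ⬝ᵥ S.Q *ᵥ (D₁ *ᵥ w) := by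
    rw [← dotProduct_mulVec_transpose, transpose_transpose, ← dotProduct_mulVec_transpose,
      Q_transpose]
  have h2 : ∀ u, (D₂ᵀ *ᵥ u) ⬝ᵥ w = u ⬝ᵥ (D₂ *ᵥ w) := fun u => by
    rw [← dotProduct_mulVec_transpose, transpose_transpose]
  rw [worstDisturbance, add_dotProduct, sub_dotProduct, smul_dotProduct, h1, h2, h2, smul_eq_mul]

lemma worstDisturbance_dotProduct_self
    (hD₁ : D₁ * D₁ᵀ = (2 : ℝ) • S.R + (1 - g) • (S.B * S.Bᵀ)) (hD₂ : D₂ * D₂ᵀ = 1)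
    (hD₁₂ : D₁ * D₂ᵀ = 0) (e y : Fin n → ℝ) :
    S.worstDisturbance g X D₁ D₂ e y ⬝ᵥ S.worstDisturbance g X D₁ D₂ e y =
      2 * (e ⬝ᵥ (S.Q * S.R * S.Q) *ᵥ e) + (1 - g) * ((S.C *ᵥ e) ⬝ᵥ (S.C *ᵥ e)) +
      ((S.C *ᵥ e) ⬝ᵥ (S.C *ᵥ e) - 2 * g * ((S.C *ᵥ e) ⬝ᵥ (S.Bᵀ *ᵥ (X *ᵥ y))) +
        g ^ 2 * ((S.Bᵀ *ᵥ (X *ᵥ y)) ⬝ᵥ (S.Bᵀ *ᵥ (X *ᵥ y)))) := by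
  rw [dotProduct_worstDisturbance, mulVec_worstDisturbance_left hD₁ hD₁₂,
    mulVec_worstDisturbance_right hD₂ hD₁₂]
  simp only [mulVec_add, mulVec_smul, dotProduct_add, dotProduct_smul, dotProduct_neg, quad_QB,
    smul_eq_mul, ← mulVec_mulVec _ S.Q, ← mulVec_mulVec _ _ S.Q, Matrix.mul_assoc,
    dotProduct_comm (S.Bᵀ *ᵥ (X *ᵥ y)) (S.C *ᵥ e)]
  ring

/-- Derivative of the estimation error along the closed loop. -/
def errorRate (S : PHSystem n m) (g : ℝ) (D₁ : Matrix (Fin n) (Fin l) ℝ)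
    (D₂ : Matrix (Fin m) (Fin l) ℝ) (e y : Fin n → ℝ) (w : Fin l → ℝ) : Fin n → ℝ :=
  S.A *ᵥ e - g • S.B *ᵥ (S.C *ᵥ y) - S.B *ᵥ (S.C *ᵥ e) + D₁ *ᵥ w - S.B *ᵥ (D₂ *ᵥ w)

/-- Derivative of the controller state along the closed loop. -/
def controllerRate (S : PHSystem n m) (g : ℝ) (X : Matrix (Fin n) (Fin n) ℝ)
    (D₂ : Matrix (Fin m) (Fin l) ℝ) (e y : Fin n → ℝ) (w : Fin l → ℝ) : Fin n → ℝ :=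
  (S.A + g • (S.B * S.C)) *ᵥ y + S.B *ᵥ (S.C *ᵥ e) - S.B *ᵥ (S.Bᵀ *ᵥ (X *ᵥ y)) +
    S.B *ᵥ (D₂ *ᵥ w)

lemma output_dotProduct_self (hE₁ : E₁ᵀ * E₁ = S.Cᵀ * S.C) (hE₂ : E₂ᵀ * E₂ = 1)
    (hE₁₂ : E₁ᵀ * E₂ = 0) (x : Fin n → ℝ) (q : Fin m → ℝ) :
    (E₁ *ᵥ x - E₂ *ᵥ q) ⬝ᵥ (E₁ *ᵥ x - E₂ *ᵥ q) = (S.C *ᵥ x) ⬝ᵥ (S.C *ᵥ x) + q ⬝ᵥ q := by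
  have h1 : (E₁ *ᵥ x) ⬝ᵥ (E₁ *ᵥ x) = (S.C *ᵥ x) ⬝ᵥ (S.C *ᵥ x) := by
    rw [← dotProduct_mulVec_transpose, mulVec_mulVec, hE₁, ← mulVec_mulVec,
      dotProduct_mulVec_transpose]
  have h2 : (E₂ *ᵥ q) ⬝ᵥ (E₂ *ᵥ q) = q ⬝ᵥ q := by
    rw [← dotProduct_mulVec_transpose, mulVec_mulVec, hE₂, one_mulVec]
  have h3 : (E₁ *ᵥ x) ⬝ᵥ (E₂ *ᵥ q) = 0 := by
    rw [← dotProduct_mulVec_transpose, mulVec_mulVec, hE₁₂, zero_mulVec, dotProduct_zero]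
  rw [sub_dotProduct, dotProduct_sub, dotProduct_sub, h1, h2, dotProduct_comm (E₂ *ᵥ q), h3]
  ring

/-- The dissipation equality of the closed loop for the storage function
`γ² eᵀ Q e + yᵀ X y`, where `g = γ⁻²`. -/
lemma dissipation_equality {γ : ℝ} (hγ : γ ≠ 0) (hg : g = (γ ^ 2)⁻¹) (hX : Xᵀ = X)
    (hr : riccati (S.A + g • (S.B * S.C)) ((1 - g) • (S.B * S.Bᵀ)) (S.Cᵀ * S.C) X = 0)
    (hD₁ : D₁ * D₁ᵀ = (2 : ℝ) • S.R + (1 - g) • (S.B * S.Bᵀ)) (hD₂ : D₂ * D₂ᵀ = 1)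
    (hD₁₂ : D₁ * D₂ᵀ = 0) (hE₁ : E₁ᵀ * E₁ = S.Cᵀ * S.C) (hE₂ : E₂ᵀ * E₂ = 1)
    (hE₁₂ : E₁ᵀ * E₂ = 0) (e y : Fin n → ℝ) (w : Fin l → ℝ) :
    2 * γ ^ 2 * (e ⬝ᵥ S.Q *ᵥ S.errorRate g D₁ D₂ e y w) +
      2 * (y ⬝ᵥ X *ᵥ S.controllerRate g X D₂ e y w) +
      (E₁ *ᵥ (e + y) - E₂ *ᵥ (S.Bᵀ *ᵥ (X *ᵥ y))) ⬝ᵥ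
        (E₁ *ᵥ (e + y) - E₂ *ᵥ (S.Bᵀ *ᵥ (X *ᵥ y))) - γ ^ 2 * (w ⬝ᵥ w) =
      -(γ ^ 2 * ((w - S.worstDisturbance g X D₁ D₂ e y) ⬝ᵥ
        (w - S.worstDisturbance g X D₁ D₂ e y))) := by
  have hXB : ∀ u : Fin m → ℝ, y ⬝ᵥ X *ᵥ (S.B *ᵥ u) = (S.Bᵀ *ᵥ (X *ᵥ y)) ⬝ᵥ u := fun u => by
    rw [← dotProduct_mulVec_transpose, transpose_transpose, ← dotProduct_mulVec_transpose, hX]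
  have hric : 2 * (y ⬝ᵥ X *ᵥ ((S.A + g • (S.B * S.C)) *ᵥ y)) =
      (1 - g) * ((S.Bᵀ *ᵥ (X *ᵥ y)) ⬝ᵥ (S.Bᵀ *ᵥ (X *ᵥ y))) - (S.C *ᵥ y) ⬝ᵥ (S.C *ᵥ y) := by
    have h := congrArg (fun M => y ⬝ᵥ M *ᵥ y) hr
    simp only [riccati, zero_mulVec, dotProduct_zero, add_mulVec _ (S.Cᵀ * S.C), sub_mulVec,
      dotProduct_add, dotProduct_sub, quad_lyapunov hX] at h
    have h1 : y ⬝ᵥ (S.Cᵀ * S.C) *ᵥ y = (S.C *ᵥ y) ⬝ᵥ (S.C *ᵥ y) := by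
      rw [← mulVec_mulVec, dotProduct_mulVec_transpose]
    have h2 : y ⬝ᵥ (X * (1 - g) • (S.B * S.Bᵀ) * X) *ᵥ y =
        (1 - g) * ((S.Bᵀ *ᵥ (X *ᵥ y)) ⬝ᵥ (S.Bᵀ *ᵥ (X *ᵥ y))) := by
      rw [Matrix.mul_smul, Matrix.smul_mul, smul_mulVec, dotProduct_smul, smul_eq_mul,
        ← mulVec_mulVec, ← mulVec_mulVec, ← mulVec_mulVec, hXB]
    rw [h1, h2] at h
    linarith
  rw [output_dotProduct_self hE₁ hE₂ hE₁₂]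
  simp only [sub_dotProduct w, dotProduct_sub w, dotProduct_sub _ w,
    dotProduct_comm w (S.worstDisturbance g X D₁ D₂ e y)]
  rw [worstDisturbance_dotProduct_self hD₁ hD₂ hD₁₂, dotProduct_worstDisturbance]
  simp only [errorRate, controllerRate, mulVec_add, mulVec_sub, mulVec_smul, dotProduct_add,
    dotProduct_sub, dotProduct_smul, add_dotProduct, quad_QA, quad_QB, hXB, smul_eq_mul,
    mul_add, mul_sub, hric, dotProduct_comm (S.Bᵀ *ᵥ (X *ᵥ y)) (S.C *ᵥ e),
    dotProduct_comm (S.C *ᵥ y) (S.C *ᵥ e)]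
  -- All forms are now reduced to common scalars; what remains is a polynomial identity using `g γ²
  -- = 1`.
  subst hg
  field_simp
  ring

/-- The only phasor along which the worst-case disturbance is stationary is zero. -/
lemma worstDisturbance_phasor_eq_zero (hobs : IsObservablePair S.A S.C) (hg : g < 1)
    (hs : AsymptoticallyStable (S.A + g • (S.B * S.C) - (1 - g) • (S.B * S.Bᵀ) * X))
    (hD₁ : D₁ * D₁ᵀ = (2 : ℝ) • S.R + (1 - g) • (S.B * S.Bᵀ)) (hD₂ : D₂ * D₂ᵀ = 1)
    (hD₁₂ : D₁ * D₂ᵀ = 0) {ω : ℝ} {e₁ e₂ y₁ y₂ : Fin n → ℝ}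
    (he₁ : S.errorRate g D₁ D₂ e₁ y₁ (S.worstDisturbance g X D₁ D₂ e₁ y₁) = -(ω • e₂))
    (he₂ : S.errorRate g D₁ D₂ e₂ y₂ (S.worstDisturbance g X D₁ D₂ e₂ y₂) = ω • e₁)
    (hy₁ : S.controllerRate g X D₂ e₁ y₁ (S.worstDisturbance g X D₁ D₂ e₁ y₁) = -(ω • y₂))
    (hy₂ : S.controllerRate g X D₂ e₂ y₂ (S.worstDisturbance g X D₁ D₂ e₂ y₂) = ω • y₁) :
    (e₁ = 0 ∧ e₂ = 0) ∧ y₁ = 0 ∧ y₂ = 0 := by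
  -- The measurement part of the worst disturbance cancels `C e`, which decouples `y` from `e` and
  -- leaves the stabilized matrix of the control equation.
  have hctrl : ∀ e y, S.controllerRate g X D₂ e y (S.worstDisturbance g X D₁ D₂ e y) =
      (S.A + g • (S.B * S.C) - (1 - g) • (S.B * S.Bᵀ) * X) *ᵥ y := by
    intro e y
    rw [controllerRate, mulVec_worstDisturbance_right hD₂ hD₁₂, sub_mulVec, ← mulVec_mulVec,
      smul_mulVec (1 - g), ← mulVec_mulVec, mulVec_add, mulVec_neg, mulVec_smul]
    module
  rw [hctrl] at hy₁ hy₂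
  obtain ⟨rfl, rfl⟩ := asymptoticallyStable_iff.1 hs 0 ω y₁ y₂ (by rw [hy₁]; simp)
    (by rw [hy₂]; simp) le_rfl
  have herr : ∀ e, S.errorRate g D₁ D₂ e 0 (S.worstDisturbance g X D₁ D₂ e 0) =
      S.A *ᵥ e + (2 : ℝ) • S.R *ᵥ (S.Q *ᵥ e) + (1 - g) • S.B *ᵥ (S.C *ᵥ e) := by
    intro e
    rw [errorRate, mulVec_worstDisturbance_left hD₁ hD₁₂, mulVec_worstDisturbance_right hD₂ hD₁₂]
    simp only [mulVec_zero, smul_zero, add_zero, mulVec_neg]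
    module
  rw [herr] at he₁ he₂
  -- The worst disturbance reverses the sign of the dissipation: the error can only gain energy. A
  -- purely oscillating error therefore has `R Q e = 0` and `C e = 0`.
  have hquad : ∀ e, e ⬝ᵥ S.Q *ᵥ (S.A *ᵥ e + (2 : ℝ) • S.R *ᵥ (S.Q *ᵥ e) +
      (1 - g) • S.B *ᵥ (S.C *ᵥ e)) =
      (S.Q *ᵥ e) ⬝ᵥ S.R *ᵥ (S.Q *ᵥ e) + (1 - g) * ((S.C *ᵥ e) ⬝ᵥ (S.C *ᵥ e)) := by
    intro e
    have h : e ⬝ᵥ S.Q *ᵥ (S.R *ᵥ (S.Q *ᵥ e)) = (S.Q *ᵥ e) ⬝ᵥ S.R *ᵥ (S.Q *ᵥ e) := by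
      rw [← dotProduct_mulVec_transpose, Q_transpose]
    simp only [mulVec_add, mulVec_smul, dotProduct_add, dotProduct_smul, quad_QA, quad_QB,
      smul_eq_mul, ← mulVec_mulVec, h]
    ring
  have hbal := energy_balance S.Q_transpose (σ := 0) (ω := ω) (a := e₁) (b := e₂)
    (he₁.trans (by simp)) (he₂.trans (by simp))
  rw [zero_mul, hquad, hquad] at hbal
  have hb : 0 < 1 - g := sub_pos.2 hg
  have hC : ∀ e, 0 ≤ (1 - g) * ((S.C *ᵥ e) ⬝ᵥ (S.C *ᵥ e)) := fun e =>
    mul_nonneg hb.le (by simpa using dotProduct_star_self_nonneg (S.C *ᵥ e))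
  have hR : ∀ e, 0 ≤ (S.Q *ᵥ e) ⬝ᵥ S.R *ᵥ (S.Q *ᵥ e) := fun e => S.R_posSemidef.quad_nonneg _
  have h1 := hC e₁
  have h2 := hC e₂
  have h3 := hR e₁
  have h4 := hR e₂
  have hCz : ∀ e, (1 - g) * ((S.C *ᵥ e) ⬝ᵥ (S.C *ᵥ e)) = 0 → S.C *ᵥ e = 0 := fun e he =>
    dotProduct_self_eq_zero.1 ((mul_eq_zero.1 he).resolve_left hb.ne')
  have hC₁ := hCz e₁ (by linarith)
  have hC₂ := hCz e₂ (by linarith)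
  have hR₁ := S.R_posSemidef.mulVec_eq_zero (v := S.Q *ᵥ e₁) (by linarith)
  have hR₂ := S.R_posSemidef.mulVec_eq_zero (v := S.Q *ᵥ e₂) (by linarith)
  rw [hC₁, hR₁] at he₁
  rw [hC₂, hR₂] at he₂
  exact ⟨hobs.eigenvector_eq_zero (σ := 0) (ω := ω) (by simpa using he₁) (by simpa using he₂)
    hC₁ hC₂, rfl, rfl⟩

/-- The closed loop written in terms of the estimation error and the controller state. -/
lemma closedLoop_rates {A' : Matrix (Fin n) (Fin n) ℝ}
    (hA' : A' = S.A - (1 - g) • (S.B * S.C) - S.B * S.Bᵀ * X) {x : Fin n ⊕ Fin n → ℝ}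
    {w : Fin l → ℝ} {u : Fin n ⊕ Fin n → ℝ}
    (h : closedLoopA S.A S.B S.C A' S.B (S.Bᵀ * X) *ᵥ x + closedLoopD S.B D₁ D₂ *ᵥ w = u) :
    S.errorRate g D₁ D₂ (x ∘ Sum.inl - x ∘ Sum.inr) (x ∘ Sum.inr) w =
      u ∘ Sum.inl - u ∘ Sum.inr ∧
    S.controllerRate g X D₂ (x ∘ Sum.inl - x ∘ Sum.inr) (x ∘ Sum.inr) w = u ∘ Sum.inr := by
  rw [closedLoopA, closedLoopD, fromBlocks_mulVec, fromRows_mulVec] at h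
  have h1 : S.A *ᵥ (x ∘ Sum.inl) + -(S.B * (S.Bᵀ * X)) *ᵥ (x ∘ Sum.inr) + D₁ *ᵥ w = u ∘ Sum.inl :=
    congrArg (· ∘ Sum.inl) h
  have h2 : (S.B * S.C) *ᵥ (x ∘ Sum.inl) + A' *ᵥ (x ∘ Sum.inr) + (S.B * D₂) *ᵥ w = u ∘ Sum.inr :=
    congrArg (· ∘ Sum.inr) h
  rw [← h1, ← h2, hA']
  simp only [errorRate, controllerRate, mulVec_sub, add_mulVec, sub_mulVec, smul_mulVec,
    neg_mulVec, ← mulVec_mulVec]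
  constructor <;> module

/-- The `H∞` bound for the closed loop. -/
lemma hInfNorm_closedLoop_lt (hobs : IsObservablePair S.A S.C) {γ : ℝ} (hγ : 1 < γ)
    (hg : g = (γ ^ 2)⁻¹) (hX : Xᵀ = X)
    (hr : riccati (S.A + g • (S.B * S.C)) ((1 - g) • (S.B * S.Bᵀ)) (S.Cᵀ * S.C) X = 0)
    (hs : AsymptoticallyStable (S.A + g • (S.B * S.C) - (1 - g) • (S.B * S.Bᵀ) * X))
    (hD₁ : D₁ * D₁ᵀ = (2 : ℝ) • S.R + (1 - g) • (S.B * S.Bᵀ)) (hD₂ : D₂ * D₂ᵀ = 1)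
    (hD₁₂ : D₁ * D₂ᵀ = 0) (hE₁ : E₁ᵀ * E₁ = S.Cᵀ * S.C) (hE₂ : E₂ᵀ * E₂ = 1)
    (hE₁₂ : E₁ᵀ * E₂ = 0) {A' : Matrix (Fin n) (Fin n) ℝ}
    (hA' : A' = S.A - (1 - g) • (S.B * S.C) - S.B * S.Bᵀ * X)
    (hst : AsymptoticallyStable (closedLoopA S.A S.B S.C A' S.B (S.Bᵀ * X))) :
    hInfNorm (transferFunction (closedLoopA S.A S.B S.C A' S.B (S.Bᵀ * X))
      (closedLoopD S.B D₁ D₂) (closedLoopE (S.Bᵀ * X) E₁ E₂)) < ENNReal.ofReal γ := by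
  have hγ0 : 0 < γ := zero_lt_one.trans hγ
  have hg1 : g < 1 := hg ▸ inv_lt_one_of_one_lt₀ (one_lt_pow₀ hγ two_ne_zero)
  refine hInfNorm_lt_of_phasor hst hγ0 fun ω x₁ x₂ w₁ w₂ hw h₁ h₂ => ?_
  obtain ⟨he₁, hy₁⟩ := closedLoop_rates hA' h₁
  obtain ⟨he₂, hy₂⟩ := closedLoop_rates hA' h₂
  have hout : ∀ x : Fin n ⊕ Fin n → ℝ, closedLoopE (S.Bᵀ * X) E₁ E₂ *ᵥ x =
      E₁ *ᵥ ((x ∘ Sum.inl - x ∘ Sum.inr) + x ∘ Sum.inr) -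
        E₂ *ᵥ (S.Bᵀ *ᵥ (X *ᵥ (x ∘ Sum.inr))) := by
    intro x
    rw [closedLoopE, fromCols_mulVec, neg_mulVec, ← mulVec_mulVec, ← mulVec_mulVec,
      sub_add_cancel, sub_eq_add_neg]
  rw [hout, hout]
  set e₁ := x₁ ∘ Sum.inl - x₁ ∘ Sum.inr
  set e₂ := x₂ ∘ Sum.inl - x₂ ∘ Sum.inr
  set y₁ := x₁ ∘ Sum.inr
  set y₂ := x₂ ∘ Sum.inr
  replace he₁ : S.errorRate g D₁ D₂ e₁ y₁ w₁ = -(ω • e₂) := he₁.trans (by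
    funext i; simp [e₂]; ring)
  replace he₂ : S.errorRate g D₁ D₂ e₂ y₂ w₂ = ω • e₁ := he₂.trans (by
    funext i; simp [e₁]; ring)
  replace hy₁ : S.controllerRate g X D₂ e₁ y₁ w₁ = -(ω • y₂) := hy₁
  replace hy₂ : S.controllerRate g X D₂ e₂ y₂ w₂ = ω • y₁ := hy₂
  -- On the imaginary axis `σ = 0`, so both storage terms drop out of the summed dissipation
  -- equalities.
  have hbe := energy_balance S.Q_transpose (σ := 0) (ω := ω) (a := e₁) (b := e₂)
    (he₁.trans (by simp)) (he₂.trans (by simp))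
  have hby := energy_balance hX (σ := 0) (ω := ω) (a := y₁) (b := y₂)
    (hy₁.trans (by simp)) (hy₂.trans (by simp))
  rw [zero_mul] at hbe hby
  have hd₁ := dissipation_equality hγ0.ne' hg hX hr hD₁ hD₂ hD₁₂ hE₁ hE₂ hE₁₂ e₁ y₁ w₁
  have hd₂ := dissipation_equality hγ0.ne' hg hX hr hD₁ hD₂ hD₁₂ hE₁ hE₂ hE₁₂ e₂ y₂ w₂
  set v₁ := w₁ - S.worstDisturbance g X D₁ D₂ e₁ y₁ with hv₁
  set v₂ := w₂ - S.worstDisturbance g X D₁ D₂ e₂ y₂ with hv₂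
  have hnn : ∀ v : Fin l → ℝ, 0 ≤ v ⬝ᵥ v := fun v => by
    simpa using dotProduct_star_self_nonneg v
  -- Strictness: otherwise the disturbance is the worst-case one, all phasors vanish, and `w₁ = w₂ =
  -- 0`.
  have hpos : 0 < γ ^ 2 * (v₁ ⬝ᵥ v₁ + v₂ ⬝ᵥ v₂) := by
    refine mul_pos (by positivity) ((add_nonneg (hnn v₁) (hnn v₂)).lt_of_ne' fun h0 => hw ?_)
    have hz₁ : v₁ = 0 := dotProduct_self_eq_zero.1 (by linarith [hnn v₁, hnn v₂])
    have hz₂ : v₂ = 0 := dotProduct_self_eq_zero.1 (by linarith [hnn v₁, hnn v₂])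
    have hw₁ := sub_eq_zero.1 (hv₁.symm.trans hz₁)
    have hw₂ := sub_eq_zero.1 (hv₂.symm.trans hz₂)
    rw [hw₁] at he₁ hy₁
    rw [hw₂] at he₂ hy₂
    obtain ⟨⟨h1, h2⟩, h3, h4⟩ :=
      worstDisturbance_phasor_eq_zero hobs hg1 hs hD₁ hD₂ hD₁₂ he₁ he₂ hy₁ hy₂
    rw [hw₁, hw₂, h1, h2, h3, h4]
    simp [worstDisturbance]
  have h3 : 2 * γ ^ 2 * (e₁ ⬝ᵥ S.Q *ᵥ S.errorRate g D₁ D₂ e₁ y₁ w₁ +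
      e₂ ⬝ᵥ S.Q *ᵥ S.errorRate g D₁ D₂ e₂ y₂ w₂) = 0 := by rw [hbe, mul_zero]
  linarith

end WorstCase

end PHSystem

/-! ### Main theorem -/

theorem theorem3p3 {n m : ℕ} (S : PHSystem n m) (hmin : IsMinimalSystem S.A S.B S.C)
    (γ : ℝ) (hγ : 1 < γ) :
    -- `Q⁻¹` is the unique stabilizing solution of the filter equation
    (IsStabilizingFilterSolution γ S.A S.R S.B S.C S.Q⁻¹ ∧
      ∀ Y, IsStabilizingFilterSolution γ S.A S.R S.B S.C Y → Y = S.Q⁻¹) ∧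
    -- the control equation has a unique stabilizing solution
    (∃! X, IsStabilizingControlSolution γ S.A S.B S.C S.Q⁻¹ X) ∧
    ∀ Y X, IsStabilizingFilterSolution γ S.A S.R S.B S.C Y →
      IsStabilizingControlSolution γ S.A S.B S.C Y X →
      X.PosDef ∧
      -- the controller is port-Hamiltonian with Hamiltonian `X`
      IsPortHamiltonianWith (controllerA γ S.A S.B S.C Y X) (controllerB S.C Y)
        (controllerC S.B X) X ∧
      -- the closed-loop bound
      (SatisfiesStrongLure (controllerA γ S.A S.B S.C Y X) (controllerB S.C Y)
          (controllerC S.B X) 0 →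
        ∀ (l : ℕ) (D₁ : Matrix (Fin n) (Fin l) ℝ) (D₂ : Matrix (Fin m) (Fin l) ℝ)
          (E₁ : Matrix (Fin l) (Fin n) ℝ) (E₂ : Matrix (Fin l) (Fin m) ℝ),
          D₁ * D₁ᵀ = (2 : ℝ) • S.R + (1 - (γ ^ 2)⁻¹) • (S.B * S.Bᵀ) →
          D₂ * D₂ᵀ = 1 → D₁ * D₂ᵀ = 0 →
          E₁ᵀ * E₁ = S.Cᵀ * S.C → E₂ᵀ * E₂ = 1 → E₁ᵀ * E₂ = 0 →
          AsymptoticallyStable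
            (closedLoopA S.A S.B S.C (controllerA γ S.A S.B S.C Y X) (controllerB S.C Y)
              (controllerC S.B X)) ∧
          hInfNorm
            (transferFunction
              (closedLoopA S.A S.B S.C (controllerA γ S.A S.B S.C Y X) (controllerB S.C Y)
                (controllerC S.B X))
              (closedLoopD (controllerB S.C Y) D₁ D₂)
              (closedLoopE (controllerC S.B X) E₁ E₂)) < ENNReal.ofReal γ) := by
  have hobs : IsObservablePair S.A S.C := isObservablePair_of_rank hmin.2
  have hg0 : 0 ≤ (γ ^ 2)⁻¹ := by positivity
  have hg1 : (γ ^ 2)⁻¹ < 1 := inv_lt_one_of_one_lt₀ (one_lt_pow₀ hγ two_ne_zero)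
  have hfilter := PHSystem.isStabilizingFilterSolution_inv_Q hobs hγ
  refine ⟨⟨hfilter, fun Y hY => IsStabilizingFilterSolution.unique hY hfilter⟩,
    PHSystem.existsUnique_control_solution hobs hγ, fun Y X hY hXsol => ?_⟩
  obtain rfl := IsStabilizingFilterSolution.unique hY hfilter
  obtain ⟨hX, hr, hs⟩ := PHSystem.isStabilizingControlSolution_inv_Q_iff.1 hXsol
  have hXpos := PHSystem.posDef_of_control_riccati hobs (sub_pos.2 hg1).le hX hr hs
  have hB' : controllerB S.C S.Q⁻¹ = S.B := S.inv_Q_mul_C_transpose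
  have hA' : controllerA γ S.A S.B S.C S.Q⁻¹ X =
      S.A - (1 - (γ ^ 2)⁻¹) • (S.B * S.C) - S.B * S.Bᵀ * X := by
    rw [controllerA, S.inv_Q_mul_C_transpose]
  rw [hB', controllerC]
  refine ⟨hXpos, isPortHamiltonianWith_of_dissipation hXpos ?_ rfl, ?_⟩
  · rw [hA']
    exact PHSystem.controller_dissipation hg0 hX hr
  · rintro ⟨-, hrank, P, G, L, W, hP, hG, hlyap, hout, hW⟩ l D₁ D₂ E₁ E₂ hD₁ hD₂ hD₁₂ hE₁ hE₂ hE₁₂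
    -- Zero feedthrough gives `Wᵀ W = 0`, hence `Bᵀ X = Bᵀ P`: the controller output is collocated
    -- for the strict storage `P` as well as for `X`.
    have hW0 : W = 0 := by
      rw [transpose_zero, add_zero] at hW
      rw [← conjTranspose_mul_self_eq_zero]
      simpa using hW
    have hC' : S.Bᵀ * X = S.Bᵀ * P := by
      rw [hW0, Matrix.mul_zero, sub_eq_zero] at hout
      have := congrArg Matrix.transpose hout
      rwa [transpose_transpose, transpose_mul, hP.posSemidef.transpose_eq] at this
    have hst := PHSystem.asymptoticallyStable_closedLoop hobs hrank hP
      (hG.posSemidef_add (posSemidef_mul_transpose L))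
      (hlyap.trans (neg_add' (L * Lᵀ) G).symm) hC'
    exact ⟨hst, PHSystem.hInfNorm_closedLoop_lt hobs hγ rfl hX hr hs hD₁ hD₂ hD₁₂ hE₁ hE₂ hE₁₂
      hA' hst⟩
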